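/- Let $\mathbb T=\mathbb R/\mathbb Z$, and let $\|\cdot\|$ denote the usual (flat) metric of $\mathbb T$ and of $\mathbb T^2$. The following objects are fixed: a minimal rotation $T(x,y)=(x+a,y+b)$ of $\mathbb T^2$; a point $z_0\in\mathbb T^2$, with $z_{2n}=T^nz_0$ and $z_{2n+1}=T^{-n-1}z_0$ for $n\ge 0$, and $z_n=(x_n,y_n)$; the bijections $\sigma,\tau$ of $\mathbb N$ with $Tz_n=z_{\sigma(n)}$ and $T^{-1}z_n=z_{\tau(n)}$; numbers $1=\epsilon_0>\epsilon_1>\cdots>0$ with $\epsilon_k\to0$; subdivisions $\epsilon_{k+1}=c_{k,0}<c_{k,1}<c_{k,2}<c_{k,3}<c_{k,4}=\epsilon_k$; and a dense sequence $(q_k)_{k\ge0}$ in $[0,1]$. Put $X=(\mathbb T\setminus\{x_n:n\ge0\})\times\mathbb T$. **The maps $h^\alpha_t$.** For $\alpha\in[0,1]^{\mathbb N}$ let $p_\alpha:(0,1]\to\mathbb R$ be the continuous function that equals $q_0/4$ on $[c_{0,0},c_{0,1}]$ and $\alpha(0)/4$ on $[c_{0,2},c_{0,3}]$, equals $\alpha(k)/4$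 on $[c_{k,0},c_{k,1}]$ and $q_k/4$ on $[c_{k,2},c_{k,3}]$ for $k\ge1$, has $p_\alpha(1)=-1/4$, and is affine on each $[c_{k,1},c_{k,2}]$ and $[c_{k,3},c_{k,4}]$. For $0<t\le1$ let $h^\alpha_t:[-1,1]\to[-1,1]$ be the function whose graph is the polyline through $$(-1,-1),\ \left(-\tfrac{1+t}2,-t\right),\ \left(-\tfrac12,-\tfrac t2\right),\ \left(-p_\alpha(t),\tfrac t4\right),\ \left(\tfrac12,\tfrac t2\right),\ \left(\tfrac{1+t}2,t\right),\ (1,1),$$ let $h^\alpha_0$ be the polyline through $(-1,-1),(-\frac12,0),(\frac12,0),(1,1)$, and put $h^\alpha_{-t}=h^\alpha_t$. **The maps $\Phi_\alpha$.** For positive numbers $\delta_n=\delta_{\alpha,n}$ let $A_{\alpha,n}=\{z_n+(t,s):|t|,|s|\le\delta_{n}\}$, let $$\Lambda_{\alpha,n}(z_n+(t,s))=z_n+\bigl(t,\ h^\alpha_t\bigl((h^\alpha_{\delta_{n}})^{-1}(s)\bigr)\bigr)\qquad(|t|,|s|\le\delta_{n}),$$ let $\Lambda_{\alpha,n}$ be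 the identity off $A_{\alpha,n}$, and let $\Phi_{\alpha,n}=\Lambda_{\alpha,n}\circ\cdots\circ\Lambda_{\alpha,0}$, $\Phi^\sigma_{\alpha,n}=\Lambda_{\alpha,\sigma(n)}\circ\cdots\circ\Lambda_{\alpha,\sigma(0)}$ and $\Phi^\tau_{\alpha,n}=\Lambda_{\alpha,\tau(n)}\circ\cdots\circ\Lambda_{\alpha,\tau(0)}$. The sequence $(\delta_{\alpha,n})_n$ is called admissible for $\alpha$ if: 1. $A_{\alpha,m}\cap A_{\alpha,n}=\emptyset$ whenever $0<|n-m|\le5$; 2. $0<\delta_n<2^{-n}$ for all $n$; for all $m<n$, $A_{\alpha,n}$ is disjoint from $\{x_m\}\times\mathbb T$ and $\delta_n<\|x_m-x_n\|/n$; and for all $n\ge1$ and $u,v\in\{x_n\}\times\mathbb T$, $\|\Phi_{\alpha,n-1}(u)-\Phi_{\alpha,n-1}(v)\|\le\delta_n$ implies $\|u-v\|<1/n$; 3. there are integers $a_n\ge2$ with $\prod_{n\ge1}(1-1/a_n)>0$ such that, for all $m>n\ge1$ and all $u,v\in\mathbb T^2$ with $\|u-v\|\ge1/n$, $$\|\Phi_{\alpha,m}(u)-\Phi_{\alpha,m}(v)\|\ge\prod_{r=n+1}^m(1-1/a_r)\,\|\Phi_{\alpha,n}(u)-\Phi_{\alpha,n}(v)\|;$$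 4. the maps $(\Phi^\sigma_{\alpha,n})^{-1}\circ T\circ\Phi_{\alpha,n}$ and $(\Phi^\tau_{\alpha,n})^{-1}\circ T^{-1}\circ\Phi_{\alpha,n}$ $(n\ge0)$ are uniformly continuous on $X$, and both sequences of maps are uniformly Cauchy on $X$. (Here $(\Phi^\sigma_{\alpha,n})^{-1}$ and $(\Phi^\tau_{\alpha,n})^{-1}$ are the inverses of the bijections of $X$ induced by $\Phi^\sigma_{\alpha,n}$ and $\Phi^\tau_{\alpha,n}$.) Let $\Phi_\alpha=\lim_n\Phi_{\alpha,n}$; it restricts to a bijection of $X$. **Lemma.** Let $\alpha,\beta\in[0,1]^{\mathbb N}$, and let $(\delta_{\alpha,n})_n$ and $(\delta_{\beta,n})_n$ be admissible for $\alpha$ and $\beta$ respectively. Then $\Phi_\alpha^{-1}\circ T\circ\Phi_\alpha$ and $\Phi_\beta^{-1}\circ T\circ\Phi_\beta$, as self-maps of $X$, extend to unique homeomorphisms $S_\alpha$ and $S_\beta$ of $\mathbb T^2$. Moreover, for any sequences $(w_n)_{n\ge0}$, $(w'_n)_{n\ge0}$ in $\mathbb T^2$ with $\Phi_\alpha(w_n)=\Phi_\beta(w'_n)=T^nz_0=z_{2n}$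 for all $n\ge 0$, the homeomorphisms $S_\alpha$ and $S_\beta$ are topologically conjugate if and only if $(w_n)\,E_{\rm tt}\,(w'_n)$, that is, for every strictly increasing sequence $(r_k)$ of natural numbers, $(w_{r_k})_k$ converges if and only if $(w'_{r_k})_k$ converges. -/

import Mathlib

open Set Filter Topology

noncomputable section

/-- Two sequences have the same convergent subsequences. -/
def Ett {X : Type*} [TopologicalSpace X] (x y : ℕ → X) : Prop :=
  ∀ r : ℕ → ℕ, StrictMono r →
    ((∃ a, Tendsto (fun k => x (r k)) atTop (𝓝 a)) ↔
      (∃ b, Tendsto (fun k => y (r k)) atTop (𝓝 b)))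

/-- Topological conjugacy of two homeomorphisms. -/
def TopConjugate {X Y : Type*} [TopologicalSpace X] [TopologicalSpace Y]
    (f : X ≃ₜ X) (g : Y ≃ₜ Y) : Prop :=
  ∃ φ : X ≃ₜ Y, ∀ x, φ (f x) = g (φ x)

namespace DenjoyRees

/-- The torus, with circle `ℝ / ℤ`. -/
abbrev Torus : Type := UnitAddCircle × UnitAddCircle

/-- The flat (Euclidean) metric of the torus. -/
def tdist (z w : Torus) : ℝ := Real.sqrt (dist z.1 w.1 ^ 2 + dist z.2 w.2 ^ 2)

/-- The representative in `[-1/2, 1/2)` of a point of the circle. -/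
def rep (x : UnitAddCircle) : ℝ := (AddCircle.equivIco (1 : ℝ) (-1 / 2) x : ℝ)

/-- The value at `s` of the affine function through `(x₀, y₀)` and `(x₁, y₁)`. -/
def seg (x₀ y₀ x₁ y₁ s : ℝ) : ℝ := y₀ + (y₁ - y₀) / (x₁ - x₀) * (s - x₀)

/-- The objects that are fixed once and for all, before any parameter sequence is considered. -/
structure Setup where
  /-- the translation vector `(a, b)` of the rotation -/
  v : Torus
  /-- the rotation by `v` is minimal: all its orbits are dense -/
  minimal : ∀ z : Torus, Dense (Set.range fun n : ℤ => z + n • v)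
  /-- the base point of the fixed orbit -/
  z₀ : Torus
  /-- a decreasing sequence `1 = ε 0 > ε 1 > ⋯` of positive numbers with limit `0` -/
  ε : ℕ → ℝ
  ε_pos : ∀ k, 0 < ε k
  ε_zero : ε 0 = 1
  ε_anti : StrictAnti ε
  ε_lim : Tendsto ε atTop (𝓝 0)
  /-- the subdivision of `[ε (k+1), ε k]` into four intervals `[c k i, c k (i+1)]` -/
  c : ℕ → Fin 5 → ℝ
  c_mono : ∀ k, StrictMono (c k)
  c_zero : ∀ k, c k 0 = ε (k + 1)
  c_four : ∀ k, c k 4 = ε k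
  /-- a dense sequence in `[0, 1]` -/
  q : ℕ → unitInterval
  q_dense : DenseRange q

/-- `T z_n = z_{σ n}`. -/
def sigma (n : ℕ) : ℕ := if n % 2 = 0 then n + 2 else if n = 1 then 0 else n - 2

/-- `T⁻¹ z_n = z_{τ n}`. -/
def tau (n : ℕ) : ℕ := if n % 2 = 1 then n + 2 else if n = 0 then 1 else n - 2

namespace Setup

variable (D : Setup)

/-- The rotation `T`. -/
def T (z : Torus) : Torus := z + D.v

/-- The inverse rotation. -/
def Tinv (z : Torus) : Torus := z - D.v

/-- `z_{2m} = T^m z₀` and `z_{2m+1} = T^{-m-1} z₀`. -/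
def z (n : ℕ) : Torus :=
  if n % 2 = 0 then D.z₀ + (n / 2) • D.v else D.z₀ - (n / 2 + 1) • D.v

/-- The torus without the vertical circles through the points `z_n`. -/
def X : Set Torus := {w | ∀ n, w.1 ≠ (D.z n).1}

/-- The value of `p_α` on the first (lowest) quarter `[c k 0, c k 1]`. -/
def low (α : ℕ → unitInterval) : ℕ → ℝ
  | 0 => (D.q 0 : ℝ) / 4
  | k + 1 => (α (k + 1) : ℝ) / 4

/-- The value of `p_α` on the third quarter `[c k 2, c k 3]`. -/
def high (α : ℕ → unitInterval) : ℕ → ℝ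
  | 0 => (α 0 : ℝ) / 4
  | k + 1 => (D.q (k + 1) : ℝ) / 4

/-- The value of `p_α` at `ε k`. -/
def top (α : ℕ → unitInterval) : ℕ → ℝ
  | 0 => -1 / 4
  | k + 1 => D.low α k

/-- For `0 < t ≤ 1`, the index `k` with `ε (k+1) < t ≤ ε k`. -/
def level (t : ℝ) : ℕ := sInf {k : ℕ | D.ε (k + 1) < t}

/-- The continuous function `p_α` on `(0, 1]`: constant on the first and third quarters, affine on
the second and fourth ones. -/
def p (α : ℕ → unitInterval) (t : ℝ) : ℝ :=
  let k := D.level t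
  if t ≤ D.c k 1 then D.low α k
  else if t ≤ D.c k 2 then seg (D.c k 1) (D.low α k) (D.c k 2) (D.high α k) t
  else if t ≤ D.c k 3 then D.high α k
  else seg (D.c k 3) (D.high α k) (D.c k 4) (D.top α k) t

/-- For `0 < t ≤ 1`, the polyline `h^α_t` through `(-1, -1)`, `(-(1+t)/2, -t)`, `(-1/2, -t/2)`,
`(-p_α(t), t/4)`, `(1/2, t/2)`, `((1+t)/2, t)`, `(1, 1)`. For `t = 0` this is the polyline through
`(-1, -1)`, `(-1/2, 0)`, `(1/2, 0)`, `(1, 1)`. -/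
def hpos (α : ℕ → unitInterval) (t s : ℝ) : ℝ :=
  if s ≤ -(1 + t) / 2 then seg (-1) (-1) (-(1 + t) / 2) (-t) s
  else if s ≤ -1 / 2 then seg (-(1 + t) / 2) (-t) (-1 / 2) (-t / 2) s
  else if s ≤ -D.p α t then seg (-1 / 2) (-t / 2) (-D.p α t) (t / 4) s
  else if s ≤ 1 / 2 then seg (-D.p α t) (t / 4) (1 / 2) (t / 2) s
  else if s ≤ (1 + t) / 2 then seg (1 / 2) (t / 2) ((1 + t) / 2) t s
  else seg ((1 + t) / 2) t 1 1 s

/-- The function `h^α`, even in `t`. -/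
def h (α : ℕ → unitInterval) (t s : ℝ) : ℝ := D.hpos α |t| s

/-- The inverse of `h^α_t` as a self-map of `[-1, 1]`. -/
def hinv (α : ℕ → unitInterval) (t : ℝ) : ℝ → ℝ :=
  Function.invFunOn (D.h α t) (Set.Icc (-1) 1)

/-- The square with centre `z_n` and side `2 * d`. -/
def A (d : ℝ) (n : ℕ) : Set Torus :=
  {w | ∃ t s : ℝ, |t| ≤ d ∧ |s| ≤ d ∧ w = D.z n + ((t : UnitAddCircle), (s : UnitAddCircle))}

open Classical in
/-- The map `Λ_{α,n}`: `z_n + (t, s) ↦ z_n + (t, h^α_t ((h^α_d)⁻¹ s))` for `|t|, |s| ≤ d`, and the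
identity outside this square; here `d < 1/2` is the half side of the square. -/
def Lam (α : ℕ → unitInterval) (d : ℝ) (n : ℕ) (w : Torus) : Torus :=
  if w ∈ D.A d n then
    (w.1, (D.z n).2 +
      ((D.h α (rep (w.1 - (D.z n).1)) (D.hinv α d (rep (w.2 - (D.z n).2))) : ℝ) : UnitAddCircle))
  else w

/-- The composition `Λ_{α,e(n)} ∘ ⋯ ∘ Λ_{α,e(1)} ∘ Λ_{α,e(0)}`. -/
def PhiAlong (α : ℕ → unitInterval) (δ : ℕ → ℝ) (e : ℕ → ℕ) : ℕ → Torus → Torus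
  | 0 => D.Lam α (δ (e 0)) (e 0)
  | n + 1 => D.Lam α (δ (e (n + 1))) (e (n + 1)) ∘ PhiAlong α δ e n

/-- The map `Φ_{α,n} = Λ_{α,n} ∘ ⋯ ∘ Λ_{α,0}`. -/
def PhiN (α : ℕ → unitInterval) (δ : ℕ → ℝ) (n : ℕ) : Torus → Torus :=
  D.PhiAlong α δ id n

/-- The map `(Φ^σ_{α,n})⁻¹ ∘ T ∘ Φ_{α,n}` on `X`. -/
def fwd (α : ℕ → unitInterval) (δ : ℕ → ℝ) (n : ℕ) : Torus → Torus :=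
  Function.invFunOn (D.PhiAlong α δ sigma n) D.X ∘ D.T ∘ D.PhiN α δ n

/-- The map `(Φ^τ_{α,n})⁻¹ ∘ T⁻¹ ∘ Φ_{α,n}` on `X`. -/
def bwd (α : ℕ → unitInterval) (δ : ℕ → ℝ) (n : ℕ) : Torus → Torus :=
  Function.invFunOn (D.PhiAlong α δ tau n) D.X ∘ D.Tinv ∘ D.PhiN α δ n

/-- The requirements on the half sides `δ n` of the squares in the construction with parameter
sequence `α`. -/
structure Admissible (α : ℕ → unitInterval) (δ : ℕ → ℝ) : Prop where
  pos : ∀ n, 0 < δ n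
  lt_pow : ∀ n, δ n < 1 / 2 ^ n
  /-- squares with close indices are disjoint -/
  disjoint : ∀ m n, m < n → n ≤ m + 5 → Disjoint (D.A (δ m) m) (D.A (δ n) n)
  /-- a square does not meet the vertical circles through the earlier points -/
  column : ∀ m n, m < n → Disjoint {w : Torus | w.1 = (D.z m).1} (D.A (δ n) n)
  lt_dist : ∀ m n, m < n → δ n < dist (D.z m).1 (D.z n).1 / n
  fibre : ∀ n, ∀ x y : Torus, x.1 = (D.z (n + 1)).1 → y.1 = (D.z (n + 1)).1 →
    tdist (D.PhiN α δ n x) (D.PhiN α δ n y) ≤ δ (n + 1) → tdist x y < 1 / ((n : ℝ) + 1)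
  /-- distances of points are not contracted too much by the later maps -/
  expand : ∃ a : ℕ → ℕ, (∀ n, 2 ≤ a n) ∧
    (∃ l : ℝ, 0 < l ∧
      Tendsto (fun N => ∏ r ∈ Finset.Icc 1 N, (1 - 1 / (a r : ℝ))) atTop (𝓝 l)) ∧
    ∀ n : ℕ, 1 ≤ n → ∀ x y : Torus, 1 / (n : ℝ) ≤ tdist x y → ∀ m, n < m →
      (∏ r ∈ Finset.Ioc n m, (1 - 1 / (a r : ℝ))) * tdist (D.PhiN α δ n x) (D.PhiN α δ n y)
        ≤ tdist (D.PhiN α δ m x) (D.PhiN α δ m y)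
  fwd_unif : ∀ n, UniformContinuousOn (D.fwd α δ n) D.X
  bwd_unif : ∀ n, UniformContinuousOn (D.bwd α δ n) D.X
  fwd_cauchy : UniformCauchySeqOn (D.fwd α δ) atTop D.X
  bwd_cauchy : UniformCauchySeqOn (D.bwd α δ) atTop D.X

/-- The map `Φ_α = lim Φ_{α,n}`. -/
def Phi (α : ℕ → unitInterval) (δ : ℕ → ℝ) (w : Torus) : Torus :=
  limUnder atTop fun n => D.PhiN α δ n w

/-- The homeomorphism `S` of the torus extends the self-map `Φ_α⁻¹ ∘ T ∘ Φ_α` of `X`. -/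
def IsExtension (α : ℕ → unitInterval) (δ : ℕ → ℝ) (S : Torus ≃ₜ Torus) : Prop :=
  Set.EqOn S (Function.invFunOn (D.Phi α δ) D.X ∘ D.T ∘ D.Phi α δ) D.X

end Setup

end DenjoyRees

end

/-!
Each `Λ_n` slides the vertical fibres of a square and is injective except on the fibre through
`z_n`, where a segment collapses to `z_n`. Hence `Φ` is a continuous surjection that blows up
exactly the orbit of `z₀`, into fibres whose diameters tend to `0`.

Disjoint squares commute, so `Φ^σ_{2k+1}` is `Φ_{2k}` followed by a single `Λ_{2k+2}`, and likewise
for `τ`; therefore `Φ^σ_n` and `Φ^τ_n` tend to `Φ` along a subsequence, and the uniform limits of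
the maps in the last admissibility condition are lifts of `T` and `T⁻¹` through `Φ`.

Let `S` and `R` be the lifts of `T` through `Φ` and `Ψ`. If `S` and `R` are conjugate by `φ`, then
`Ψ ∘ φ - Φ` is `S`-invariant, hence constant, and its value must be a multiple of the rotation
vector `v` because `φ` maps a nontrivial fibre into a fibre. After composing with a power of `R` we
get `Ψ ∘ ψ = Φ`, so `ψ (w_n)` and `w'_n` lie in the same small fibre and have the same convergent
subsequences. Conversely, `w` and `w'` are dense, and the cluster points of `(w_n, w'_n)` form the
graph of a homeomorphism, which conjugates `S` to `R`.
-/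

section Sequences

theorem exists_strictMono_tendsto_dist_of_mapClusterPt {X : Type*} [PseudoMetricSpace X]
    {f c : ℕ → X} (h : ∀ n, MapClusterPt (c n) atTop f) :
    ∃ φ : ℕ → ℕ, StrictMono φ ∧ Tendsto (fun n => dist (f (φ n)) (c n)) atTop (𝓝 0) := by
  obtain ⟨φ, hφ, hclose⟩ := extraction_forall_of_frequently
    (P := fun n k => dist (f k) (c n) < 1 / ((n : ℝ) + 1))
    fun n => (h n).frequently (Metric.ball_mem_nhds _ Nat.one_div_pos_of_nat)
  exact ⟨φ, hφ, squeeze_zero (fun _ => dist_nonneg) (fun n => (hclose n).le)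
    tendsto_one_div_add_atTop_nhds_zero_nat⟩

theorem mapClusterPt_of_tendsto_dist {X ι : Type*} [PseudoMetricSpace X] {l : Filter ι}
    {f g : ι → X} {x : X} (hf : MapClusterPt x l f)
    (h : Tendsto (fun i => dist (f i) (g i)) l (𝓝 0)) : MapClusterPt x l g := by
  obtain ⟨U, hU, hlim⟩ := mapClusterPt_iff_ultrafilter.1 hf
  exact mapClusterPt_iff_ultrafilter.2 ⟨U, hU, hlim.congr_dist (h.mono_left hU)⟩

theorem mapClusterPt_of_comp_of_unique_preimage {K G : Type*} [TopologicalSpace K] [CompactSpace K]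
    [TopologicalSpace G] [T2Space G] {Φ : K → G} (hΦ : Continuous Φ) {u : K}
    (hu : ∀ x, Φ x = Φ u → x = u) {w : ℕ → K} (hw : MapClusterPt (Φ u) atTop (Φ ∘ w)) :
    MapClusterPt u atTop w := by
  obtain ⟨U, hU, hlim⟩ := mapClusterPt_iff_ultrafilter.1 hw
  obtain ⟨x, -, hx⟩ := isCompact_univ.ultrafilter_le_nhds (U.map w) (by simp)
  have hΦx : Φ x = Φ u := tendsto_nhds_unique ((hΦ.tendsto x).comp hx) hlim
  rw [hu x hΦx] at hx
  exact mapClusterPt_iff_ultrafilter.2 ⟨U, hU, hx⟩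

theorem exists_mapClusterPt_prodMk {X Y : Type*} [TopologicalSpace X] [TopologicalSpace Y]
    [CompactSpace Y] {u : ℕ → X} {x : X} (hx : MapClusterPt x atTop u) (v : ℕ → Y) :
    ∃ y, MapClusterPt (x, y) atTop fun n => (u n, v n) := by
  obtain ⟨U, hU, hlim⟩ := mapClusterPt_iff_ultrafilter.1 hx
  obtain ⟨y, -, hy⟩ := isCompact_univ.ultrafilter_le_nhds (U.map v) (by simp)
  exact ⟨y, mapClusterPt_iff_ultrafilter.2 ⟨U, hU, hlim.prodMk_nhds hy⟩⟩

theorem continuous_of_isClosed_graph {X Y : Type*} [TopologicalSpace X] [TopologicalSpace Y]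
    [CompactSpace Y] {f : X → Y} (hf : IsClosed {p : X × Y | p.2 = f p.1}) : Continuous f := by
  refine continuous_iff_isClosed.2 fun C hC => ?_
  have hpre : f ⁻¹' C = Prod.fst '' ({p : X × Y | p.2 = f p.1} ∩ Prod.snd ⁻¹' C) := by
    ext x
    simp
  rw [hpre]
  exact isClosedMap_fst_of_compactSpace _ (hf.inter (hC.preimage continuous_snd))

theorem tendsto_two_mul_add_atTop (c : ℕ) : Tendsto (fun k => 2 * k + c) atTop atTop :=
  tendsto_atTop_mono (fun k => show k ≤ 2 * k + c by omega) tendsto_id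

theorem le_prod_Ioc_of_tendsto {f : ℕ → ℝ} (h₀ : ∀ n, 0 ≤ f n) (h₁ : ∀ n, f n ≤ 1) {l : ℝ}
    (hl : Tendsto (fun N => ∏ r ∈ Finset.Icc 1 N, f r) atTop (𝓝 l)) (n m : ℕ) :
    l ≤ ∏ r ∈ Finset.Ioc n m, f r := by
  have anti := Finset.prod_anti_set_of_le_one h₀ h₁
  have hIcc : Antitone fun N => ∏ r ∈ Finset.Icc 1 N, f r :=
    fun _ _ h => anti (Finset.Icc_subset_Icc_right h)
  refine (hIcc.le_of_tendsto hl m).trans (anti fun r hr => ?_)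
  rw [Finset.mem_Ioc] at hr
  exact Finset.mem_Icc.2 ⟨by omega, hr.2⟩

end Sequences

section Extension

theorem exists_continuous_of_uniformCauchySeqOn {X Y : Type*} [UniformSpace X] [UniformSpace Y]
    [CompleteSpace Y] [T3Space Y] [Nonempty Y] {s : Set X} (hs : Dense s) {f : ℕ → X → Y}
    (hf : ∀ n, UniformContinuousOn (f n) s) (hcauchy : UniformCauchySeqOn f atTop s) :
    ∃ F : X → Y, Continuous F ∧ ∀ x ∈ s, Tendsto (fun n => f n x) atTop (𝓝 (F x)) := by
  have hex (x : X) (hx : x ∈ s) : ∃ y, Tendsto (fun n => f n x) atTop (𝓝 y) :=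
    cauchySeq_tendsto_of_complete (hcauchy.cauchySeq hx)
  choose! g hg using hex
  have hg_unif : UniformContinuous (s.domRestrict g) := uniformContinuousOn_iff_restrict.1
    ((hcauchy.tendstoUniformlyOn_of_tendsto hg).uniformContinuousOn (Frequently.of_forall hf))
  refine ⟨hs.extend (s.domRestrict g), (hs.uniformContinuous_extend hg_unif).continuous,
    fun x hx => ?_⟩
  rw [hs.extend_of_ind hg_unif ⟨x, hx⟩]
  exact hg x hx

theorem tendstoUniformly_comp_of_tendsto_id {X Y ι : Type*} [UniformSpace Y] {l : Filter ι}
    {g : ι → Y → Y} {f : ι → X → Y} {F : X → Y} (hg : TendstoUniformly g id l)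
    (hf : TendstoUniformly f F l) : TendstoUniformly (fun i => g i ∘ f i) F l := by
  intro U hU
  obtain ⟨V, hV, hVU⟩ := comp_mem_uniformity_sets hU
  filter_upwards [hg V hV, hf V hV] with i hgi hfi x
  exact hVU ⟨f i x, hfi x, hgi (f i x)⟩

theorem exists_homeomorph_of_semiconj {X Y : Type*} [TopologicalSpace X] [T2Space X] {Φ : X → Y}
    {s : Set X} (hs : Dense s) (hΦ : ∀ u ∈ s, ∀ x, Φ x = Φ u → x = u) {T T' : Y → Y}
    (hTT' : Function.LeftInverse T T') (hT'T : Function.LeftInverse T' T) {F F' : X → X}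
    (hF : Continuous F) (hF' : Continuous F') (hFT : Function.Semiconj Φ F T)
    (hFT' : Function.Semiconj Φ F' T') : ∃ S : X ≃ₜ X, ⇑S = F := by
  have eq_self {f : X → X} (hf : Continuous f) (h : ∀ u, Φ (f u) = Φ u) (x : X) : f x = x :=
    congrFun (hf.ext_on hs continuous_id fun u hu => hΦ u hu _ (h u)) x
  exact ⟨{ toFun := F
           invFun := F'
           left_inv := eq_self (hF'.comp hF) fun u => by
             rw [hFT'.eq, hFT.eq, hT'T]
           right_inv := eq_self (hF.comp hF') fun u => by
             rw [hFT.eq, hFT'.eq, hTT']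
           continuous_toFun := hF
           continuous_invFun := hF' }, rfl⟩

end Extension

namespace Ett

theorem symm {X : Type*} [TopologicalSpace X] {u v : ℕ → X} (h : Ett u v) : Ett v u :=
  fun r hr => (h r hr).symm

theorem trans {X : Type*} [TopologicalSpace X] {u v w : ℕ → X} (h : Ett u v) (h' : Ett v w) :
    Ett u w :=
  fun r hr => (h r hr).trans (h' r hr)

theorem of_tendsto_dist {X : Type*} [PseudoMetricSpace X] {u v : ℕ → X}
    (h : Tendsto (fun n => dist (u n) (v n)) atTop (𝓝 0)) : Ett u v := by
  intro r hr
  have hr' := h.comp hr.tendsto_atTop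
  exact ⟨fun ⟨a, ha⟩ => ⟨a, ha.congr_dist hr'⟩,
    fun ⟨b, hb⟩ => ⟨b, hb.congr_dist (hr'.congr fun _ => dist_comm _ _)⟩⟩

theorem comp_homeomorph {X : Type*} [TopologicalSpace X] (ψ : X ≃ₜ X) (u : ℕ → X) :
    Ett u (ψ ∘ u) := by
  refine fun r _ => ⟨fun ⟨a, ha⟩ => ⟨ψ a, (ψ.continuous.tendsto a).comp ha⟩, fun ⟨b, hb⟩ => ?_⟩
  exact ⟨ψ.symm b, by simpa [Function.comp_def] using (ψ.symm.continuous.tendsto b).comp hb⟩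

variable {X : Type*} [MetricSpace X] {u v : ℕ → X}

theorem mapClusterPt_unique (h : Ett u v) {x y z : X}
    (hy : MapClusterPt (x, y) atTop fun n => (u n, v n))
    (hz : MapClusterPt (x, z) atTop fun n => (u n, v n)) : y = z := by
  let c : ℕ → X × X := fun n => if Even n then (x, y) else (x, z)
  have hc_even (n : ℕ) : c (2 * n) = (x, y) := if_pos (even_two_mul n)
  have hc_odd (n : ℕ) : c (2 * n + 1) = (x, z) := if_neg (by simp)
  obtain ⟨φ, hφ, hdist⟩ := exists_strictMono_tendsto_dist_of_mapClusterPt (c := c)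
    (f := fun n => (u n, v n)) fun n => by
      by_cases hn : Even n
      · simpa only [c, if_pos hn] using hy
      · simpa only [c, if_neg hn] using hz
  have hu : Tendsto (fun n => u (φ n)) atTop (𝓝 x) := by
    refine tendsto_iff_dist_tendsto_zero.2
      (squeeze_zero (fun _ => dist_nonneg) (fun n => ?_) hdist)
    have hx : (c n).1 = x := by dsimp only [c]; split_ifs <;> rfl
    exact (congrArg _ hx.symm).trans_le (le_max_left _ _)
  obtain ⟨b, hb⟩ := (h φ hφ).1 ⟨x, hu⟩
  have hc : Tendsto (fun n => (c n).2) atTop (𝓝 b) :=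
    hb.congr_dist (squeeze_zero (fun _ => dist_nonneg) (fun n => le_max_right _ _) hdist)
  have hyb := hc.comp (tendsto_two_mul_add_atTop 0)
  have hzb := hc.comp (tendsto_two_mul_add_atTop 1)
  simp only [Function.comp_def, add_zero, hc_even, hc_odd, tendsto_const_nhds_iff] at hyb hzb
  exact hyb.trans hzb.symm

theorem exists_homeomorph [CompactSpace X] (h : Ett u v) (hu : ∀ x, MapClusterPt x atTop u)
    (hv : ∀ x, MapClusterPt x atTop v) :
    ∃ φ : X ≃ₜ X, ∀ x y, MapClusterPt (x, y) atTop (fun n => (u n, v n)) ↔ y = φ x := by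
  have swap {u v : ℕ → X} {x y : X} (hxy : MapClusterPt (x, y) atTop fun n => (u n, v n)) :
      MapClusterPt (y, x) atTop fun n => (v n, u n) :=
    hxy.continuousAt_comp (f := Prod.swap) continuous_swap.continuousAt
  choose f hf using fun x => exists_mapClusterPt_prodMk (hu x) v
  choose g hg using fun x => exists_mapClusterPt_prodMk (hv x) u
  have hf' (x y : X) : MapClusterPt (x, y) atTop (fun n => (u n, v n)) ↔ y = f x :=
    ⟨fun hy => h.mapClusterPt_unique hy (hf x), fun e => e ▸ hf x⟩
  have hg' (x y : X) : MapClusterPt (x, y) atTop (fun n => (v n, u n)) ↔ y = g x :=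
    ⟨fun hy => h.symm.mapClusterPt_unique hy (hg x), fun e => e ▸ hg x⟩
  refine ⟨{ toFun := f
            invFun := g
            left_inv := fun x => ((hg' _ _).1 (swap (hf x))).symm
            right_inv := fun x => ((hf' _ _).1 (swap (hg x))).symm
            continuous_toFun := continuous_of_isClosed_graph ?_
            continuous_invFun := continuous_of_isClosed_graph ?_ }, hf'⟩
  · simpa only [← hf', MapClusterPt] using isClosed_setOfPred_clusterPt
  · simpa only [← hg', MapClusterPt] using isClosed_setOfPred_clusterPt

end Ett

namespace DenjoyRees

theorem semiconj_zpow {K G : Type*} [TopologicalSpace K] [AddGroup G] {Φ : K → G} {v : G}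
    {S : K ≃ₜ K} (hS : Function.Semiconj Φ S (· + v)) (k : ℤ) :
    Function.Semiconj Φ ⇑(S ^ k) (· + k • v) := by
  have hS_symm (x : K) : Φ (S.symm x) = Φ x + -v :=
    eq_add_neg_of_add_eq ((hS.eq _).symm.trans (congrArg Φ (S.apply_symm_apply x)))
  induction k with
  | zero => simp [Function.Semiconj]
  | succ n ih =>
    intro x
    rw [add_comm, zpow_one_add, Homeomorph.mul_apply, hS.eq, ih.eq, add_comm 1, add_one_zsmul,
      add_assoc]
  | pred n ih =>
    intro x
    rw [sub_eq_neg_add, zpow_add, zpow_neg_one, Homeomorph.mul_apply, Homeomorph.inv_apply,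
      hS_symm, ih.eq, ← sub_eq_neg_add, sub_zsmul, one_zsmul, add_assoc]

/-- A blow-up of the orbit `z₀ + ℤ v` of a rotation of a group: a map that is injective over the
complement of this orbit, on a dense set of points, while the diameters of its fibres over the
forward orbit tend to `0`. In the construction of Rees this is the map `Φ_α`. -/
structure OrbitBlowup {K G : Type*} [MetricSpace K] [TopologicalSpace G] [AddGroup G]
    (v z₀ : G) (Φ : K → G) : Prop where
  continuous : Continuous Φ
  eq_or_mem_orbit : ∀ x y, Φ x = Φ y → x = y ∨ ∃ k : ℤ, Φ x = z₀ + k • v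
  dense_compl_orbit : Dense {x | ∀ k : ℤ, Φ x ≠ z₀ + k • v}
  tendsto_diam : Tendsto (fun n : ℕ => Metric.diam (Φ ⁻¹' {z₀ + n • v})) atTop (𝓝 0)
  nontrivial : (Φ ⁻¹' {z₀}).Nontrivial

namespace OrbitBlowup

variable {K G : Type*} [MetricSpace K] [TopologicalSpace G] [AddCommGroup G]
  {v z₀ : G} {Φ Ψ : K → G}

theorem eq_of_forall_ne (hΦ : OrbitBlowup v z₀ Φ) {x u : K} (hu : ∀ k : ℤ, Φ u ≠ z₀ + k • v)
    (h : Φ x = Φ u) : x = u :=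
  (hΦ.eq_or_mem_orbit x u h).resolve_right fun ⟨k, hk⟩ => hu k (h.symm.trans hk)

theorem exists_zsmul_eq (hΦ : OrbitBlowup v z₀ Φ) (hΨ : OrbitBlowup v z₀ Ψ) {φ : K → K}
    (hφ : φ.Injective) {c : G} (hc : ∀ x, Ψ (φ x) = Φ x + c) : ∃ k : ℤ, c = k • v := by
  obtain ⟨x, hx, y, hy, hxy⟩ := hΦ.nontrivial
  simp only [mem_preimage, mem_singleton_iff] at hx hy
  obtain ⟨k, hk⟩ := (hΨ.eq_or_mem_orbit (φ x) (φ y) (by rw [hc, hc, hx, hy])).resolve_left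
    (hφ.ne hxy)
  exact ⟨k, by simpa [hc, hx] using hk⟩

variable [CompactSpace K]

theorem tendsto_dist (hΦ : OrbitBlowup v z₀ Φ) {x y : ℕ → K}
    (hx : ∀ n : ℕ, Φ (x n) = z₀ + n • v) (hy : ∀ n : ℕ, Φ (y n) = z₀ + n • v) :
    Tendsto (fun n => dist (x n) (y n)) atTop (𝓝 0) :=
  squeeze_zero (fun _ => dist_nonneg)
    (fun n => Metric.dist_le_diam_of_mem Metric.isBounded_of_compactSpace (hx n) (hy n))
    hΦ.tendsto_diam

theorem tendsto_dist_succ (hΦ : OrbitBlowup v z₀ Φ) {S : K → K}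
    (hS : Function.Semiconj Φ S (· + v)) {w : ℕ → K} (hw : ∀ n : ℕ, Φ (w n) = z₀ + n • v) :
    Tendsto (fun n => dist (S (w n)) (w (n + 1))) atTop (𝓝 0) :=
  squeeze_zero (fun _ => dist_nonneg)
    (fun n => Metric.dist_le_diam_of_mem Metric.isBounded_of_compactSpace
      (by simp [hS.eq, hw, succ_nsmul, add_assoc]) (hw (n + 1)))
    (hΦ.tendsto_diam.comp (tendsto_add_atTop_nat 1))

variable [T2Space G] [CompactSpace G] [IsTopologicalAddGroup G]

theorem mapClusterPt (hΦ : OrbitBlowup v z₀ Φ) (hv : Dense (range fun k : ℤ => k • v))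
    {w : ℕ → K} (hw : ∀ n : ℕ, Φ (w n) = z₀ + n • v) (x : K) : MapClusterPt x atTop w := by
  have orbit (y : G) : MapClusterPt y atTop fun n : ℕ => z₀ + n • v := by
    have h := ((mapClusterPt_atTop_nsmul_tfae (-z₀ + y) v).out 0 3).2 (hv _)
    simpa [Function.comp_def] using h.continuousAt_comp (f := (z₀ + ·)) (by fun_prop)
  have off_orbit : {x | ∀ k : ℤ, Φ x ≠ z₀ + k • v} ⊆ {x | MapClusterPt x atTop w} := by
    refine fun u hu => mapClusterPt_of_comp_of_unique_preimage hΦ.continuous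
      (fun x => hΦ.eq_of_forall_ne hu) ?_
    simpa only [Function.comp_def, hw] using orbit (Φ u)
  exact closure_minimal off_orbit isClosed_setOfPred_clusterPt (hΦ.dense_compl_orbit x)

theorem topConjugate_of_ett (hΦ : OrbitBlowup v z₀ Φ) (hΨ : OrbitBlowup v z₀ Ψ)
    (hv : Dense (range fun k : ℤ => k • v)) {S R : K ≃ₜ K}
    (hS : Function.Semiconj Φ S (· + v)) (hR : Function.Semiconj Ψ R (· + v))
    {w w' : ℕ → K} (hw : ∀ n : ℕ, Φ (w n) = z₀ + n • v) (hw' : ∀ n : ℕ, Ψ (w' n) = z₀ + n • v)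
    (h : Ett w w') : TopConjugate S R := by
  obtain ⟨φ, hφ⟩ := h.exists_homeomorph (hΦ.mapClusterPt hv hw) (hΨ.mapClusterPt hv hw')
  refine ⟨φ, fun x => ((hφ _ _).1 ?_).symm⟩
  have image : MapClusterPt (S x, R (φ x)) atTop fun n => (S (w n), R (w' n)) :=
    ((hφ x (φ x)).2 rfl).continuousAt_comp (S.continuous.prodMap R.continuous).continuousAt
  have asymptotic := (hΦ.tendsto_dist_succ hS hw).max (hΨ.tendsto_dist_succ hR hw')
  rw [max_self] at asymptotic
  exact (mapClusterPt_of_tendsto_dist image asymptotic).of_comp (tendsto_add_atTop_nat 1)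

theorem denseRange (hΦ : OrbitBlowup v z₀ Φ) (hv : Dense (range fun k : ℤ => k • v))
    {w : ℕ → K} (hw : ∀ n : ℕ, Φ (w n) = z₀ + n • v) : DenseRange w := fun x =>
  mem_closure_iff_clusterPt.2 ((hΦ.mapClusterPt hv hw x).clusterPt.mono
    (le_principal_iff.2 range_mem_map))

theorem exists_eq_add_const (hΦ : OrbitBlowup v z₀ Φ) (hΨ : Continuous Ψ)
    (hv : Dense (range fun k : ℤ => k • v)) {S R φ : K ≃ₜ K}
    (hS : Function.Semiconj Φ S (· + v)) (hR : Function.Semiconj Ψ R (· + v))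
    (hφ : Function.Semiconj φ S R) : ∃ c, ∀ x, Ψ (φ x) = Φ x + c := by
  obtain ⟨x₀, hx₀⟩ := hΦ.nontrivial.nonempty
  have orbit (n : ℕ) : Φ (S^[n] x₀) = z₀ + n • v := by
    induction n with
    | zero => simpa using hx₀
    | succ n ih => rw [Function.iterate_succ_apply', hS.eq, ih, add_assoc, succ_nsmul]
  have invariant (n : ℕ) : Ψ (φ (S^[n] x₀)) - Φ (S^[n] x₀) = Ψ (φ x₀) - Φ x₀ := by
    induction n with
    | zero => rfl
    | succ n ih => rw [Function.iterate_succ_apply', hS.eq, hφ.eq, hR.eq, add_sub_add_right_eq_sub,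
        ih]
  have hcont : Continuous fun x => Ψ (φ x) - Φ x :=
    (hΨ.comp φ.continuous).sub hΦ.continuous
  have const := (hΦ.denseRange hv orbit).equalizer hcont continuous_const (funext invariant)
  exact ⟨Ψ (φ x₀) - Φ x₀, fun x => sub_eq_iff_eq_add'.1 (congrFun const x)⟩

theorem exists_lift_of_topConjugate (hΦ : OrbitBlowup v z₀ Φ) (hΨ : OrbitBlowup v z₀ Ψ)
    (hv : Dense (range fun k : ℤ => k • v)) {S R : K ≃ₜ K}
    (hS : Function.Semiconj Φ S (· + v)) (hR : Function.Semiconj Ψ R (· + v))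
    (h : TopConjugate S R) : ∃ ψ : K ≃ₜ K, ∀ x, Ψ (ψ x) = Φ x := by
  obtain ⟨φ, hφ⟩ := h
  obtain ⟨c, hc⟩ := hΦ.exists_eq_add_const hΨ.continuous hv hS hR hφ
  obtain ⟨k, rfl⟩ := hΦ.exists_zsmul_eq hΨ φ.injective hc
  refine ⟨φ.trans (R ^ (-k)), fun x => ?_⟩
  rw [Homeomorph.trans_apply, (semiconj_zpow hR (-k)).eq, hc, neg_zsmul, add_neg_cancel_right]

theorem topConjugate_iff_ett (hΦ : OrbitBlowup v z₀ Φ) (hΨ : OrbitBlowup v z₀ Ψ)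
    (hv : Dense (range fun k : ℤ => k • v)) {S R : K ≃ₜ K}
    (hS : Function.Semiconj Φ S (· + v)) (hR : Function.Semiconj Ψ R (· + v))
    {w w' : ℕ → K} (hw : ∀ n : ℕ, Φ (w n) = z₀ + n • v)
    (hw' : ∀ n : ℕ, Ψ (w' n) = z₀ + n • v) : TopConjugate S R ↔ Ett w w' := by
  refine ⟨fun h => ?_, hΦ.topConjugate_of_ett hΨ hv hS hR hw hw'⟩
  obtain ⟨ψ, hψ⟩ := hΦ.exists_lift_of_topConjugate hΨ hv hS hR h
  exact (Ett.comp_homeomorph ψ w).trans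
    (.of_tendsto_dist (hΨ.tendsto_dist (fun n => (hψ _).trans (hw n)) hw'))

end OrbitBlowup

section Polyline

theorem seg_left (x₀ y₀ x₁ y₁ : ℝ) : seg x₀ y₀ x₁ y₁ x₀ = y₀ := by simp [seg]

theorem seg_right {x₀ x₁ : ℝ} (h : x₀ ≠ x₁) (y₀ y₁ : ℝ) : seg x₀ y₀ x₁ y₁ x₁ = y₁ := by
  rw [seg, div_mul_cancel₀ _ (sub_ne_zero.2 h.symm), add_sub_cancel]

theorem seg_eq_of_slope {x₀ y₀ x₁ y₁ m : ℝ} (h : x₀ ≠ x₁) (hm : y₁ - y₀ = m * (x₁ - x₀)) (s : ℝ) :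
    seg x₀ y₀ x₁ y₁ s = y₀ + m * (s - x₀) := by
  rw [seg, hm, mul_div_cancel_right₀ _ (sub_ne_zero.2 h.symm)]

theorem continuous_seg (x₀ y₀ x₁ y₁ : ℝ) : Continuous (seg x₀ y₀ x₁ y₁) := by
  unfold seg
  fun_prop

theorem seg_mem_Icc {x₀ y₀ x₁ y₁ s a b : ℝ} (h : x₀ < x₁) (hs : s ∈ Icc x₀ x₁)
    (h₀ : y₀ ∈ Icc a b) (h₁ : y₁ ∈ Icc a b) : seg x₀ y₀ x₁ y₁ s ∈ Icc a b := by
  have hpos : 0 < x₁ - x₀ := sub_pos.2 h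
  have hr : (s - x₀) / (x₁ - x₀) ∈ Icc (0 : ℝ) 1 :=
    ⟨div_nonneg (sub_nonneg.2 hs.1) hpos.le, (div_le_one hpos).2 (by linarith [hs.2])⟩
  convert (convex_Icc a b).add_smul_sub_mem h₀ h₁ hr using 1
  simp only [seg, smul_eq_mul]
  ring

/-- The point of `[-1/2, 1/2]` closest to `s`. -/
noncomputable def clamp (s : ℝ) : ℝ := max (-1 / 2) (min s (1 / 2))

theorem clamp_of_le {s : ℝ} (h : s ≤ -1 / 2) : clamp s = -1 / 2 :=
  max_eq_left ((min_le_left _ _).trans h)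

theorem clamp_of_ge {s : ℝ} (h : 1 / 2 ≤ s) : clamp s = 1 / 2 := by
  rw [clamp, min_eq_right h, max_eq_right (by norm_num)]

theorem clamp_eq_self {s : ℝ} (h₁ : -1 / 2 ≤ s) (h₂ : s ≤ 1 / 2) : clamp s = s := by
  rw [clamp, min_eq_left h₂, max_eq_right h₁]

theorem continuous_clamp : Continuous clamp := by
  unfold clamp
  fun_prop

theorem clamp_mem (s : ℝ) : clamp s ∈ Icc (-1 / 2 : ℝ) (1 / 2) :=
  ⟨le_max_left _ _, max_le (by norm_num) (min_le_right _ _)⟩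

theorem monotone_clamp : Monotone clamp := fun _ _ h => max_le_max_left _ (min_le_min_right _ h)

theorem monotone_sub_clamp : Monotone fun s => s - clamp s := by
  intro s s' h
  rcases le_total s' (-1 / 2) with hs' | hs'
  · simp only [clamp_of_le hs', clamp_of_le (h.trans hs')]
    linarith
  rcases le_total (1 / 2) s with hs | hs
  · simp only [clamp_of_ge hs, clamp_of_ge (hs.trans h)]
    linarith
  have left : s - clamp s ≤ 0 := sub_nonpos.2 (le_max_of_le_right (le_min le_rfl hs))
  have right : 0 ≤ s' - clamp s' := sub_nonneg.2 (max_le hs' (min_le_left _ _))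
  exact left.trans right

theorem sub_clamp_eq_zero_iff {s : ℝ} : s - clamp s = 0 ↔ s ∈ Icc (-1 / 2 : ℝ) (1 / 2) :=
  ⟨fun h => sub_eq_zero.1 h ▸ clamp_mem s, fun h => sub_eq_zero.2 (clamp_eq_self h.1 h.2).symm⟩

theorem eq_of_sub_clamp_eq {s s' : ℝ} (h : s - clamp s = s' - clamp s') (h₀ : s - clamp s ≠ 0) :
    s = s' := by
  have cases (u : ℝ) (hu : u - clamp u ≠ 0) :
      u < -1 / 2 ∧ u - clamp u = u + 1 / 2 ∨ 1 / 2 < u ∧ u - clamp u = u - 1 / 2 := by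
    rcases lt_or_ge u (-1 / 2) with h₁ | h₁
    · exact .inl ⟨h₁, by rw [clamp_of_le h₁.le]; ring⟩
    rcases lt_or_ge (1 / 2) u with h₂ | h₂
    · exact .inr ⟨h₂, by rw [clamp_of_ge h₂.le]⟩
    · exact absurd (sub_clamp_eq_zero_iff.2 ⟨h₁, h₂⟩) hu
  rcases cases s h₀ with hs | hs <;> rcases cases s' (h ▸ h₀) with hs' | hs' <;> linarith

/-- The middle part of the polyline `h^α_t`, divided by `t`: the polyline through `(-1/2, -1/2)`,
`(-p, 1/4)`, `(1/2, 1/2)`, which is concave for `|p| ≤ 1/4`. -/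
noncomputable def bump (p c : ℝ) : ℝ :=
  min (1 / 4 + 3 / 4 / (1 / 2 - p) * (c + p)) (1 / 4 + 1 / 4 / (1 / 2 + p) * (c + p))

/-- The outer parts of the polyline `h^α_t`, moved towards the origin: the odd function with slope
`1` on `[-t/2, t/2]` and slope `2` elsewhere. -/
noncomputable def spread (t r : ℝ) : ℝ := r + max 0 (r - t / 2) + min 0 (r + t / 2)

/-- A closed form of the polyline `h^α_t` with `p = p_α(t)`. -/
noncomputable def polyline (p t s : ℝ) : ℝ := t * bump p (clamp s) + spread t (s - clamp s)

theorem strictMono_bump {p : ℝ} (hp : |p| ≤ 1 / 4) : StrictMono (bump p) := by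
  obtain ⟨h₁, h₂⟩ := abs_le.1 hp
  have affine {m : ℝ} (hm : 0 < m) : StrictMono fun c : ℝ => 1 / 4 + m * (c + p) :=
    fun _ _ h => by dsimp only; gcongr
  have left := affine (m := 3 / 4 / (1 / 2 - p)) (div_pos (by norm_num) (by linarith))
  have right := affine (m := 1 / 4 / (1 / 2 + p)) (div_pos (by norm_num) (by linarith))
  exact fun _ _ h => min_lt_min (left h) (right h)

theorem bump_of_le {p c : ℝ} (hp : |p| ≤ 1 / 4) (hc : c ≤ -p) :
    bump p c = 1 / 4 + 3 / 4 / (1 / 2 - p) * (c + p) := by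
  obtain ⟨h₁, h₂⟩ := abs_le.1 hp
  have slope : 1 / 4 / (1 / 2 + p) ≤ 3 / 4 / (1 / 2 - p) := by
    rw [div_le_div_iff₀] <;> linarith
  exact min_eq_left (add_le_add_right (mul_le_mul_of_nonpos_right slope (by linarith)) _)

theorem bump_of_ge {p c : ℝ} (hp : |p| ≤ 1 / 4) (hc : -p ≤ c) :
    bump p c = 1 / 4 + 1 / 4 / (1 / 2 + p) * (c + p) := by
  obtain ⟨h₁, h₂⟩ := abs_le.1 hp
  have slope : 1 / 4 / (1 / 2 + p) ≤ 3 / 4 / (1 / 2 - p) := by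
    rw [div_le_div_iff₀] <;> linarith
  exact min_eq_right (add_le_add_right (mul_le_mul_of_nonneg_right slope (by linarith)) _)

theorem bump_neg_half {p : ℝ} (hp : |p| ≤ 1 / 4) : bump p (-1 / 2) = -1 / 2 := by
  obtain ⟨h₁, h₂⟩ := abs_le.1 hp
  have hne : 1 / 2 - p ≠ 0 := by linarith
  rw [bump_of_le hp (by linarith), show -1 / 2 + p = -(1 / 2 - p) by ring, mul_neg,
    div_mul_cancel₀ _ hne]
  norm_num

theorem bump_half {p : ℝ} (hp : |p| ≤ 1 / 4) : bump p (1 / 2) = 1 / 2 := by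
  obtain ⟨h₁, h₂⟩ := abs_le.1 hp
  rw [bump_of_ge hp (by linarith), div_mul_cancel₀ _ (by linarith)]
  norm_num

theorem abs_bump_clamp_le {p : ℝ} (hp : |p| ≤ 1 / 4) (s : ℝ) : |bump p (clamp s)| ≤ 1 / 2 := by
  have h := (strictMono_bump hp).monotone
  obtain ⟨h₁, h₂⟩ := clamp_mem s
  refine abs_le.2 ⟨?_, (h h₂).trans_eq (bump_half hp)⟩
  exact le_trans (by rw [bump_neg_half hp]; norm_num) (h h₁)

theorem strictMono_spread (t : ℝ) : StrictMono (spread t) := fun _ _ h =>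
  add_lt_add_of_lt_of_le (add_lt_add_of_lt_of_le h (max_le_max_left _ (by linarith)))
    (min_le_min_left _ (by linarith))

theorem spread_of_le {t r : ℝ} (ht : 0 ≤ t) (hr : r ≤ -t / 2) : spread t r = 2 * r + t / 2 := by
  rw [spread, max_eq_left (by linarith), min_eq_right (by linarith)]
  ring

theorem spread_eq_self {t r : ℝ} (h₁ : -t / 2 ≤ r) (h₂ : r ≤ t / 2) : spread t r = r := by
  rw [spread, max_eq_left (by linarith), min_eq_left (by linarith)]
  ring

theorem spread_of_ge {t r : ℝ} (ht : 0 ≤ t) (hr : t / 2 ≤ r) : spread t r = 2 * r - t / 2 := by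
  rw [spread, max_eq_right (by linarith), min_eq_left (by linarith)]
  ring

theorem strictMono_polyline {p t : ℝ} (hp : |p| ≤ 1 / 4) (ht : 0 < t) :
    StrictMono (polyline p t) := by
  intro s s' h
  have hbump : StrictMono fun c => t * bump p c := (strictMono_bump hp).const_mul ht
  rcases (monotone_clamp h.le).lt_or_eq with hlt | heq
  · exact add_lt_add_of_lt_of_le (hbump hlt)
      ((strictMono_spread t).monotone (monotone_sub_clamp h.le))
  · exact add_lt_add_of_le_of_lt (hbump.monotone heq.le) (strictMono_spread t (by linarith))

theorem polyline_of_le {p t s : ℝ} (hp : |p| ≤ 1 / 4) (hs : s ≤ -1 / 2) :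
    polyline p t s = -t / 2 + spread t (s + 1 / 2) := by
  rw [polyline, clamp_of_le hs, bump_neg_half hp]
  ring_nf

theorem polyline_of_ge {p t s : ℝ} (hp : |p| ≤ 1 / 4) (hs : 1 / 2 ≤ s) :
    polyline p t s = t / 2 + spread t (s - 1 / 2) := by
  rw [polyline, clamp_of_ge hs, bump_half hp]
  ring

theorem polyline_of_mem {p t s : ℝ} (ht : 0 ≤ t) (h₁ : -1 / 2 ≤ s) (h₂ : s ≤ 1 / 2) :
    polyline p t s = t * bump p s := by
  rw [polyline, clamp_eq_self h₁ h₂, sub_self, spread_eq_self (by linarith) (by linarith),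
    add_zero]

theorem polyline_neg_square {p t d : ℝ} (hp : |p| ≤ 1 / 4) (ht : 0 ≤ t) (htd : t ≤ d) :
    polyline p t (-(1 + d) / 2) = -d := by
  rw [polyline_of_le hp (by linarith), spread_of_le ht (by linarith)]
  ring

theorem polyline_square {p t d : ℝ} (hp : |p| ≤ 1 / 4) (ht : 0 ≤ t) (htd : t ≤ d) :
    polyline p t ((1 + d) / 2) = d := by
  rw [polyline_of_ge hp (by linarith), spread_of_ge ht (by linarith)]
  ring

theorem polyline_zero (p s : ℝ) : polyline p 0 s = 2 * (s - clamp s) := by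
  rw [polyline, spread, zero_div, sub_zero, add_zero, zero_mul, zero_add, add_assoc,
    max_add_min, zero_add, two_mul]

theorem polyline_eq_seg_left {p t s : ℝ} (hp : |p| ≤ 1 / 4) (ht : 0 ≤ t) (ht1 : t < 1)
    (hs : s ≤ -1 / 2) : polyline p t s =
      if s ≤ -(1 + t) / 2 then seg (-1) (-1) (-(1 + t) / 2) (-t) s
      else seg (-(1 + t) / 2) (-t) (-1 / 2) (-t / 2) s := by
  rw [polyline_of_le hp hs]
  split_ifs with h
  · rw [spread_of_le ht (by linarith), seg_eq_of_slope (m := 2) (by linarith) (by ring)]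
    ring
  · rw [spread_eq_self (by linarith) (by linarith),
      seg_eq_of_slope (m := 1) (by linarith) (by ring)]
    ring

theorem polyline_eq_seg_middle {p t s : ℝ} (hp : |p| ≤ 1 / 4) (ht : 0 ≤ t)
    (h₁ : -1 / 2 ≤ s) (h₂ : s ≤ 1 / 2) : polyline p t s =
      if s ≤ -p then seg (-1 / 2) (-t / 2) (-p) (t / 4) s
      else seg (-p) (t / 4) (1 / 2) (t / 2) s := by
  obtain ⟨hp₁, hp₂⟩ := abs_le.1 hp
  rw [polyline_of_mem ht h₁ h₂]
  split_ifs with h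
  · have hne : 1 / 2 - p ≠ 0 := by linarith
    have slope : t / 4 - -t / 2 = t * (3 / 4 / (1 / 2 - p)) * (-p - -1 / 2) := by
      rw [show -p - -1 / 2 = 1 / 2 - p by ring, mul_assoc, div_mul_cancel₀ _ hne]
      ring
    have hseg : seg (-1 / 2) (-t / 2) (-p) (t / 4) (-p) = t / 4 := seg_right (by linarith) _ _
    rw [bump_of_le hp h]
    rw [seg_eq_of_slope (by linarith) slope] at hseg ⊢
    linear_combination -hseg
  · have hne : 1 / 2 + p ≠ 0 := by linarith
    have slope : t / 2 - t / 4 = t * (1 / 4 / (1 / 2 + p)) * (1 / 2 - -p) := by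
      rw [sub_neg_eq_add, mul_assoc, div_mul_cancel₀ _ hne]
      ring
    rw [bump_of_ge hp (not_le.1 h).le, seg_eq_of_slope (by linarith) slope]
    ring

theorem polyline_eq_seg_right {p t s : ℝ} (hp : |p| ≤ 1 / 4) (ht : 0 ≤ t) (ht1 : t < 1)
    (hs : 1 / 2 < s) : polyline p t s =
      if s ≤ (1 + t) / 2 then seg (1 / 2) (t / 2) ((1 + t) / 2) t s
      else seg ((1 + t) / 2) t 1 1 s := by
  rw [polyline_of_ge hp hs.le]
  split_ifs with h
  · rw [spread_eq_self (by linarith) (by linarith),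
      seg_eq_of_slope (m := 1) (by linarith) (by ring)]
    ring
  · rw [spread_of_ge ht (by linarith), seg_eq_of_slope (m := 2) (by linarith) (by ring)]
    ring

end Polyline

section Circle

theorem coe_rep (x : UnitAddCircle) : ((rep x : ℝ) : UnitAddCircle) = x :=
  (AddCircle.equivIco (1 : ℝ) (-1 / 2)).symm_apply_apply x

theorem norm_coe_of_abs_le {t : ℝ} (ht : |t| ≤ 1 / 2) : ‖(t : UnitAddCircle)‖ = |t| :=
  (AddCircle.norm_coe_eq_abs_iff 1 one_ne_zero).2 (by rwa [abs_one])

theorem norm_coe_le_abs (t : ℝ) : ‖(t : UnitAddCircle)‖ ≤ |t| := by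
  rw [UnitAddCircle.norm_eq]
  exact (round_le t 0).trans (by simp)

theorem abs_rep (x : UnitAddCircle) : |rep x| = ‖x‖ := by
  obtain ⟨h₁, h₂⟩ := (AddCircle.equivIco (1 : ℝ) (-1 / 2) x).2
  conv_rhs => rw [← coe_rep x]
  exact (norm_coe_of_abs_le (abs_le.2 ⟨by rw [rep]; linarith, by rw [rep]; linarith⟩)).symm

theorem rep_coe {t : ℝ} (ht : |t| < 1 / 2) : rep (t : UnitAddCircle) = t := by
  obtain ⟨h₁, h₂⟩ := abs_lt.1 ht
  exact AddCircle.equivIco_coe_of_mem ⟨by linarith, by linarith⟩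

theorem eq_of_coe_eq {s t : ℝ} (hs : |s| < 1 / 2) (ht : |t| < 1 / 2)
    (h : (s : UnitAddCircle) = t) : s = t := by
  rw [← rep_coe hs, h, rep_coe ht]

theorem continuousAt_rep {x : UnitAddCircle} (hx : ‖x‖ < 1 / 2) : ContinuousAt rep x := by
  refine continuous_subtype_val.continuousAt.comp (AddCircle.continuousAt_equivIco _ _ ?_)
  rintro rfl
  rw [norm_coe_of_abs_le (by norm_num [abs_of_neg])] at hx
  norm_num [abs_of_neg] at hx

end Circle

section TorusMetric

theorem dist_le_tdist (u v : Torus) : dist u v ≤ tdist u v :=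
  max_le (Real.le_sqrt_of_sq_le (le_add_of_nonneg_right (sq_nonneg _)))
    (Real.le_sqrt_of_sq_le (le_add_of_nonneg_left (sq_nonneg _)))

theorem tdist_of_fst_eq {u v : Torus} (h : u.1 = v.1) : tdist u v = dist u.2 v.2 := by
  rw [tdist, h, dist_self, zero_pow two_ne_zero, zero_add, Real.sqrt_sq dist_nonneg]

theorem tendsto_tdist {ι : Type*} {l : Filter ι} {f g : ι → Torus} {a b : Torus}
    (hf : Tendsto f l (𝓝 a)) (hg : Tendsto g l (𝓝 b)) :
    Tendsto (fun i => tdist (f i) (g i)) l (𝓝 (tdist a b)) :=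
  (((hf.fst_nhds.dist hg.fst_nhds).pow 2).add ((hf.snd_nhds.dist hg.snd_nhds).pow 2)).sqrt

end TorusMetric

theorem div_four_mem (r : unitInterval) : (r : ℝ) / 4 ∈ Icc (-1 / 4 : ℝ) (1 / 4) :=
  ⟨by linarith [r.2.1], by linarith [r.2.2]⟩

theorem sigma_two_mul (k : ℕ) : sigma (2 * k) = 2 * k + 2 := if_pos (by omega)

theorem sigma_two_mul_add_three (k : ℕ) : sigma (2 * k + 3) = 2 * k + 1 := by
  rw [sigma, if_neg (by omega), if_neg (by omega)]
  omega

theorem tau_two_mul_add_one (k : ℕ) : tau (2 * k + 1) = 2 * k + 3 := if_pos (by omega)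

theorem tau_two_mul_add_two (k : ℕ) : tau (2 * k + 2) = 2 * k := by
  rw [tau, if_neg (by omega), if_neg (by omega)]
  omega

namespace Setup

variable (D : Setup)

section Profile

variable (α : ℕ → unitInterval)

/-- The formula that defines `p_α` on `[ε (k+1), ε k]`, as a function on the whole line. -/
noncomputable def pPiece (k : ℕ) (t : ℝ) : ℝ :=
  if t ≤ D.c k 1 then D.low α k
  else if t ≤ D.c k 2 then seg (D.c k 1) (D.low α k) (D.c k 2) (D.high α k) t
  else if t ≤ D.c k 3 then D.high α k
  else seg (D.c k 3) (D.high α k) (D.c k 4) (D.top α k) t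

theorem p_eq_pPiece_level (t : ℝ) : D.p α t = D.pPiece α (D.level t) t := rfl

theorem c_lt {i j : Fin 5} (k : ℕ) (h : i < j := by decide) : D.c k i < D.c k j := D.c_mono k h

theorem low_mem (k : ℕ) : D.low α k ∈ Icc (-1 / 4 : ℝ) (1 / 4) := by
  cases k <;> exact div_four_mem _

theorem high_mem (k : ℕ) : D.high α k ∈ Icc (-1 / 4 : ℝ) (1 / 4) := by
  cases k <;> exact div_four_mem _

theorem top_mem (k : ℕ) : D.top α k ∈ Icc (-1 / 4 : ℝ) (1 / 4) := by
  cases k with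
  | zero => exact ⟨le_rfl, by norm_num [top]⟩
  | succ k => exact D.low_mem α k

theorem pPiece_mem {k : ℕ} {t : ℝ} (ht : t ≤ D.ε k) :
    D.pPiece α k t ∈ Icc (-1 / 4 : ℝ) (1 / 4) := by
  rw [pPiece]
  split_ifs with h₁ h₂ h₃
  · exact D.low_mem α k
  · exact seg_mem_Icc (D.c_lt k) ⟨(not_le.1 h₁).le, h₂⟩ (D.low_mem α k) (D.high_mem α k)
  · exact D.high_mem α k
  · exact seg_mem_Icc (D.c_lt k) ⟨(not_le.1 h₃).le, ht.trans_eq (D.c_four k).symm⟩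
      (D.high_mem α k) (D.top_mem α k)

theorem continuous_pPiece (k : ℕ) : Continuous (D.pPiece α k) := by
  have knots : D.c k 1 < D.c k 2 ∧ D.c k 2 < D.c k 3 := ⟨D.c_lt k, D.c_lt k⟩
  refine continuous_const.if_le ?_ continuous_id continuous_const ?_
  · refine (continuous_seg _ _ _ _).if_le ?_ continuous_id continuous_const ?_
    · refine continuous_const.if_le (continuous_seg _ _ _ _) continuous_id continuous_const ?_
      rintro t rfl
      exact (seg_left _ _ _ _).symm
    · rintro t rfl
      simp only [if_pos knots.2.le, seg_right knots.1.ne]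
  · rintro t rfl
    simp only [if_pos knots.1.le, seg_left]

theorem pPiece_ε (k : ℕ) : D.pPiece α k (D.ε k) = D.top α k := by
  have h₁ : D.c k 1 < D.c k 4 := D.c_lt k
  have h₂ : D.c k 2 < D.c k 4 := D.c_lt k
  have h₃ : D.c k 3 < D.c k 4 := D.c_lt k
  rw [← D.c_four, pPiece, if_neg h₁.not_ge, if_neg h₂.not_ge, if_neg h₃.not_ge, seg_right h₃.ne]

theorem pPiece_ε_succ (k : ℕ) : D.pPiece α k (D.ε (k + 1)) = D.top α (k + 1) := by
  rw [← D.c_zero]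
  exact if_pos (D.c_lt k).le

theorem le_ε_level {t : ℝ} (ht : t ≤ 1) : t ≤ D.ε (D.level t) := by
  rcases h : D.level t with _ | k
  · exact ht.trans_eq D.ε_zero.symm
  · exact not_lt.1 (Nat.notMem_of_lt_sInf (h ▸ k.lt_succ_self : k < D.level t))

theorem ε_level_succ_lt {t : ℝ} (ht : 0 < t) : D.ε (D.level t + 1) < t := by
  obtain ⟨k, hk⟩ := (((tendsto_add_atTop_iff_nat 1).2 D.ε_lim).eventually_lt_const ht).exists
  exact Nat.sInf_mem (s := {k | D.ε (k + 1) < t}) ⟨k, hk⟩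

theorem level_eq {k : ℕ} {t : ℝ} (h₁ : D.ε (k + 1) < t) (h₂ : t ≤ D.ε k) : D.level t = k := by
  refine le_antisymm (Nat.sInf_le h₁) (not_lt.1 fun hlt => ?_)
  have hmem := D.ε_level_succ_lt ((D.ε_pos _).trans h₁)
  exact (hmem.trans_le h₂).not_ge (D.ε_anti.antitone hlt)

theorem abs_p_le {t : ℝ} (ht : t ≤ 1) : |D.p α t| ≤ 1 / 4 := by
  obtain ⟨h₁, h₂⟩ := D.pPiece_mem α (D.le_ε_level ht)
  exact abs_le.2 ⟨by rw [p_eq_pPiece_level]; linarith, h₂⟩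

theorem p_eqOn_pPiece (k : ℕ) :
    EqOn (D.p α) (D.pPiece α k) (Icc (D.ε (k + 1)) (D.ε k)) := by
  rintro t ⟨h₁, h₂⟩
  rcases h₁.eq_or_lt with rfl | h₁
  · rw [p_eq_pPiece_level, D.level_eq (D.ε_anti (Nat.lt_succ_self _)) le_rfl, pPiece_ε,
      pPiece_ε_succ]
  · rw [p_eq_pPiece_level, D.level_eq h₁ h₂]

theorem continuousOn_p (N : ℕ) : ContinuousOn (D.p α) (Icc (D.ε N) 1) := by
  induction N with
  | zero => simp only [D.ε_zero, Icc_self, continuousOn_singleton]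
  | succ N ih =>
    rw [← Icc_union_Icc_eq_Icc (D.ε_anti N.lt_succ_self).le
      ((D.ε_anti.antitone N.zero_le).trans_eq D.ε_zero)]
    exact ((D.continuous_pPiece α N).continuousOn.congr (D.p_eqOn_pPiece α N)).union_of_isClosed
      ih isClosed_Icc isClosed_Icc

theorem continuousAt_p {t : ℝ} (h₀ : 0 < t) (h₁ : t < 1) : ContinuousAt (D.p α) t :=
  (D.continuousOn_p α _).continuousAt (Icc_mem_nhds (D.ε_level_succ_lt h₀) h₁)

end Profile

section FibreMap

variable (α : ℕ → unitInterval)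

theorem h_eq_polyline {t : ℝ} (ht : |t| < 1) (s : ℝ) :
    D.h α t s = polyline (D.p α |t|) |t| s := by
  have h₀ := abs_nonneg t
  have hp := D.abs_p_le α ht.le
  obtain ⟨hp₁, hp₂⟩ := abs_le.1 hp
  rw [h, hpos]
  rcases le_or_gt s (-1 / 2) with hs | hs
  · rw [polyline_eq_seg_left hp h₀ ht hs, if_pos hs]
  rw [if_neg (by linarith), if_neg hs.not_ge]
  rcases le_or_gt s (1 / 2) with hs' | hs'
  · rw [polyline_eq_seg_middle hp h₀ hs.le hs', if_pos hs']
  · rw [if_neg (by linarith), if_neg hs'.not_ge, polyline_eq_seg_right hp h₀ ht hs']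

theorem continuousAt_h {t : ℝ} (ht : |t| < 1) (s : ℝ) :
    ContinuousAt (Function.uncurry (D.h α)) (t, s) := by
  have near : ∀ᶠ x : ℝ × ℝ in 𝓝 (t, s), |x.1| < 1 :=
    (continuous_fst.abs.tendsto (t, s)).eventually_lt_const ht
  refine ContinuousAt.congr ?_ (near.mono fun x hx => (D.h_eq_polyline α hx x.2).symm)
  refine ContinuousAt.add ?_ ?_
  · rcases eq_or_ne t 0 with rfl | h0
    · have hlim : Tendsto (fun x : ℝ × ℝ => |x.1| * (1 / 2)) (𝓝 (0, s)) (𝓝 0) := by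
        simpa using ((continuous_fst.abs.mul_const (1 / 2 : ℝ)).tendsto ((0 : ℝ), s))
      rw [ContinuousAt, abs_zero, zero_mul]
      refine squeeze_zero_norm' (near.mono fun x hx => ?_) hlim
      rw [Real.norm_eq_abs, abs_mul, abs_abs]
      gcongr
      exact abs_bump_clamp_le (D.abs_p_le α hx.le) _
    · have hp : ContinuousAt (fun x : ℝ × ℝ => D.p α |x.1|) (t, s) :=
        ContinuousAt.comp (f := fun x : ℝ × ℝ => |x.1|) (D.continuousAt_p α (abs_pos.2 h0) ht)
          (by fun_prop)
      obtain ⟨hp₁, hp₂⟩ := abs_le.1 (D.abs_p_le α ht.le)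
      have hne₁ : (1 : ℝ) / 2 - D.p α |t| ≠ 0 := by linarith
      have hne₂ : (1 : ℝ) / 2 + D.p α |t| ≠ 0 := by linarith
      have hc := continuous_clamp
      unfold bump
      fun_prop (disch := assumption)
  · have hc := continuous_clamp
    unfold spread
    fun_prop

variable {α} {d t : ℝ}

theorem continuous_h (ht : |t| < 1) : Continuous (D.h α t) :=
  continuous_iff_continuousAt.2 fun s =>
    (D.continuousAt_h α ht s).comp (f := Prod.mk t) (by fun_prop)

theorem strictMono_h (h₀ : t ≠ 0) (ht : |t| < 1) : StrictMono (D.h α t) := by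
  rw [funext (D.h_eq_polyline α ht)]
  exact strictMono_polyline (D.abs_p_le α ht.le) (abs_pos.2 h₀)

theorem h_zero (s : ℝ) : D.h α 0 s = 2 * (s - clamp s) := by
  rw [D.h_eq_polyline α (by simp), abs_zero, polyline_zero]

theorem monotone_h (ht : |t| < 1) : Monotone (D.h α t) := by
  rcases eq_or_ne t 0 with rfl | h₀
  · rw [funext D.h_zero]
    exact monotone_sub_clamp.const_mul two_pos.le
  · exact (D.strictMono_h h₀ ht).monotone

theorem h_half (ht : |t| < 1) : D.h α t (1 / 2) = |t| / 2 := by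
  have hp := D.abs_p_le α ht.le
  rw [D.h_eq_polyline α ht, polyline_of_mem (abs_nonneg t) (by norm_num) le_rfl, bump_half hp]
  ring

theorem h_neg_half (ht : |t| < 1) : D.h α t (-1 / 2) = -|t| / 2 := by
  have hp := D.abs_p_le α ht.le
  rw [D.h_eq_polyline α ht, polyline_of_mem (abs_nonneg t) le_rfl (by norm_num), bump_neg_half hp]
  ring

theorem h_right (ht : |t| < 1) (htd : |t| ≤ d) : D.h α t ((1 + d) / 2) = d := by
  rw [D.h_eq_polyline α ht, polyline_square (D.abs_p_le α ht.le) (abs_nonneg t) htd]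

theorem h_left (ht : |t| < 1) (htd : |t| ≤ d) : D.h α t (-(1 + d) / 2) = -d := by
  rw [D.h_eq_polyline α ht, polyline_neg_square (D.abs_p_le α ht.le) (abs_nonneg t) htd]

theorem mapsTo_h (ht : |t| < 1) (htd : |t| ≤ d) :
    MapsTo (D.h α t) (Icc (-(1 + d) / 2) ((1 + d) / 2)) (Icc (-d) d) := by
  rintro u ⟨h₁, h₂⟩
  exact ⟨(D.h_left ht htd).symm.trans_le (D.monotone_h ht h₁),
    (D.monotone_h ht h₂).trans_eq (D.h_right ht htd)⟩

theorem surjOn_h (ht : |t| < 1) (htd : |t| ≤ d) :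
    SurjOn (D.h α t) (Icc (-(1 + d) / 2) ((1 + d) / 2)) (Icc (-d) d) := by
  have hd : 0 ≤ d := (abs_nonneg t).trans htd
  have ivt := intermediate_value_Icc (f := D.h α t) (show -(1 + d) / 2 ≤ (1 + d) / 2 by linarith)
    (D.continuous_h ht).continuousOn
  rwa [D.h_left ht htd, D.h_right ht htd] at ivt

theorem surjective_h (ht : |t| < 1) : Function.Surjective (D.h α t) := by
  intro y
  obtain ⟨u, -, hu⟩ := D.surjOn_h ht (le_max_left |t| |y|) (abs_le.1 (le_max_right |t| |y|))
  exact ⟨u, hu⟩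

theorem leftInvOn_hinv (h₀ : 0 < d) (hd : d < 1) :
    LeftInvOn (D.hinv α d) (D.h α d) (Icc (-(1 + d) / 2) ((1 + d) / 2)) := by
  rintro u ⟨h₁, h₂⟩
  have inj := (D.strictMono_h (α := α) h₀.ne' (by rwa [abs_of_pos h₀])).injective
  exact inj (Function.invFunOn_eq ⟨u, ⟨by linarith, by linarith⟩, rfl⟩)

theorem mapsTo_hinv (h₀ : 0 < d) (hd : d < 1) :
    MapsTo (D.hinv α d) (Icc (-d) d) (Icc (-(1 + d) / 2) ((1 + d) / 2)) :=
  (D.leftInvOn_hinv h₀ hd).mapsTo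
    (D.surjOn_h (by rwa [abs_of_pos h₀]) (abs_of_pos h₀).le)

theorem rightInvOn_hinv (h₀ : 0 < d) (hd : d < 1) :
    RightInvOn (D.hinv α d) (D.h α d) (Icc (-d) d) :=
  (D.surjOn_h (by rwa [abs_of_pos h₀]) (abs_of_pos h₀).le).leftInvOn_of_rightInvOn
    (D.leftInvOn_hinv h₀ hd)

theorem continuousOn_hinv (h₀ : 0 < d) (hd : d < 1) : ContinuousOn (D.hinv α d) (Icc (-d) d) := by
  have hd' : |d| < 1 := by rwa [abs_of_pos h₀]
  let e := (D.strictMono_h (α := α) h₀.ne' hd').orderIsoOfSurjective _ (D.surjective_h hd')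
  refine e.symm.continuous.continuousOn.congr fun s hs => ?_
  exact e.eq_symm_apply.2 (D.rightInvOn_hinv h₀ hd hs)

variable (α) in
/-- The fibre component `s ↦ h^α_t ((h^α_d)⁻¹ s)` of the maps `Λ_{α,n}`, in coordinates centred at
`z_n`. -/
noncomputable def slide (d t s : ℝ) : ℝ := D.h α t (D.hinv α d s)

theorem mapsTo_slide (h₀ : 0 < d) (hd : d < 1) (ht : |t| ≤ d) :
    MapsTo (D.slide α d t) (Icc (-d) d) (Icc (-d) d) :=
  (D.mapsTo_h (ht.trans_lt hd) ht).comp (D.mapsTo_hinv h₀ hd)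

theorem surjOn_slide (h₀ : 0 < d) (hd : d < 1) (ht : |t| ≤ d) :
    SurjOn (D.slide α d t) (Icc (-d) d) (Icc (-d) d) :=
  (D.surjOn_h (ht.trans_lt hd) ht).comp
    ((D.leftInvOn_hinv h₀ hd).surjOn (D.mapsTo_h (by rwa [abs_of_pos h₀]) (abs_of_pos h₀).le))

theorem continuousOn_slide (h₀ : 0 < d) (hd : d < 1) :
    ContinuousOn (Function.uncurry (D.slide α d)) (Icc (-d) d ×ˢ Icc (-d) d) := by
  intro x hx
  have ht : |x.1| < 1 := (abs_le.2 hx.1).trans_lt hd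
  refine (D.continuousAt_h α ht (D.hinv α d x.2)).comp_continuousWithinAt
    (f := fun x : ℝ × ℝ => (x.1, D.hinv α d x.2)) (continuousWithinAt_fst.prodMk ?_)
  exact (D.continuousOn_hinv h₀ hd x.2 hx.2).comp continuousWithinAt_snd fun y hy => hy.2

theorem slide_eq_self_of_abs_fst (h₀ : 0 < d) (hd : d < 1) {s : ℝ} (ht : |t| = d)
    (hs : s ∈ Icc (-d) d) : D.slide α d t s = s := by
  have even : D.h α t = D.h α d := by
    unfold h
    rw [ht, abs_of_pos h₀]
  rw [slide, even]
  exact D.rightInvOn_hinv h₀ hd hs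

theorem slide_eq_self_of_abs_snd (h₀ : 0 < d) (hd : d < 1) {s : ℝ} (ht : |t| ≤ d)
    (hs : |s| = d) : D.slide α d t s = s := by
  have hd' : |d| = d := abs_of_pos h₀
  have inv := D.leftInvOn_hinv (α := α) h₀ hd
  have right := inv (right_mem_Icc.2 (show -(1 + d) / 2 ≤ (1 + d) / 2 by linarith))
  have left := inv (left_mem_Icc.2 (show -(1 + d) / 2 ≤ (1 + d) / 2 by linarith))
  rw [D.h_right (by rwa [hd']) hd'.le] at right
  rw [D.h_left (by rwa [hd']) hd'.le] at left
  rcases eq_or_eq_neg_of_abs_eq hs with rfl | rfl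
  · rw [slide, right, D.h_right (ht.trans_lt hd) ht]
  · rw [slide, left, D.h_left (ht.trans_lt hd) ht]

theorem slide_zero_eq_zero_iff (h₀ : 0 < d) (hd : d < 1) {s : ℝ} (hs : s ∈ Icc (-d) d) :
    D.slide α d 0 s = 0 ↔ |s| ≤ d / 2 := by
  have hd' : |d| < 1 := by rwa [abs_of_pos h₀]
  have mono := D.strictMono_h (α := α) h₀.ne' hd'
  rw [slide, h_zero, mul_eq_zero_iff_left two_ne_zero, sub_clamp_eq_zero_iff, mem_Icc,
    ← mono.le_iff_le (b := 1 / 2), ← mono.le_iff_le (a := -1 / 2), D.h_half hd', D.h_neg_half hd',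
    abs_of_pos h₀, D.rightInvOn_hinv h₀ hd hs, abs_le, neg_div]

theorem eq_or_eq_zero_of_slide_eq (h₀ : 0 < d) (hd : d < 1) (ht : |t| ≤ d) {s s' : ℝ}
    (hs : s ∈ Icc (-d) d) (hs' : s' ∈ Icc (-d) d) (h : D.slide α d t s = D.slide α d t s') :
    s = s' ∨ t = 0 ∧ D.slide α d t s = 0 := by
  refine or_iff_not_imp_right.2 fun hne =>
    (D.rightInvOn_hinv (α := α) h₀ hd).injOn hs hs' ?_
  rcases eq_or_ne t 0 with rfl | h0
  · simp only [slide, h_zero] at h hne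
    refine eq_of_sub_clamp_eq (mul_left_cancel₀ two_ne_zero h) fun h0 => hne ⟨trivial, ?_⟩
    rw [h0, mul_zero]
  · exact (D.strictMono_h h0 (ht.trans_lt hd)).injective h

end FibreMap

section Square

variable {α : ℕ → unitInterval} {d : ℝ} {n : ℕ}

theorem A_eq_closedBall (d : ℝ) (n : ℕ) : D.A d n = Metric.closedBall (D.z n) d := by
  ext w
  rw [Metric.mem_closedBall, Prod.dist_eq, dist_eq_norm, dist_eq_norm, max_le_iff]
  constructor
  · rintro ⟨t, s, ht, hs, rfl⟩
    simp only [Prod.fst_add, Prod.snd_add, add_sub_cancel_left]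
    exact ⟨(norm_coe_le_abs t).trans ht, (norm_coe_le_abs s).trans hs⟩
  · rintro ⟨h₁, h₂⟩
    refine ⟨_, _, (abs_rep _).trans_le h₁, (abs_rep _).trans_le h₂, ?_⟩
    rw [coe_rep, coe_rep, ← Prod.mk_sub_mk, add_sub_cancel]

theorem Lam_of_notMem {w : Torus} (h : w ∉ D.A d n) : D.Lam α d n w = w := if_neg h

theorem Lam_fst (n : ℕ) (w : Torus) : (D.Lam α d n w).1 = w.1 := by
  unfold Lam
  split_ifs <;> rfl

theorem Lam_add (hd : d < 1 / 2) {t s : ℝ} (ht : |t| ≤ d) (hs : |s| ≤ d) :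
    D.Lam α d n (D.z n + ((t : UnitAddCircle), (s : UnitAddCircle))) =
      D.z n + ((t : UnitAddCircle), (D.slide α d t s : UnitAddCircle)) := by
  rw [Lam, if_pos ⟨t, s, ht, hs, rfl⟩]
  simp only [Prod.fst_add, Prod.snd_add, add_sub_cancel_left]
  rw [rep_coe (ht.trans_lt hd), rep_coe (hs.trans_lt hd)]
  rfl

theorem mapsTo_Lam (h₀ : 0 < d) (hd : d < 1 / 2) :
    MapsTo (D.Lam α d n) (D.A d n) (D.A d n) := by
  rintro _ ⟨t, s, ht, hs, rfl⟩
  rw [D.Lam_add hd ht hs]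
  exact ⟨t, _, ht, abs_le.2 (D.mapsTo_slide h₀ (by linarith) ht (abs_le.1 hs)), rfl⟩

theorem Lam_mem_iff (h₀ : 0 < d) (hd : d < 1 / 2) {w : Torus} :
    D.Lam α d n w ∈ D.A d n ↔ w ∈ D.A d n := by
  refine ⟨fun h => by_contra fun hw => hw ?_, fun h => D.mapsTo_Lam h₀ hd h⟩
  rwa [D.Lam_of_notMem hw] at h

theorem dist_Lam_le (h₀ : 0 < d) (hd : d < 1 / 2) (n : ℕ) (w : Torus) :
    dist (D.Lam α d n w) w ≤ 2 * d := by
  by_cases h : w ∈ D.A d n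
  · have h' := D.mapsTo_Lam (α := α) h₀ hd h
    rw [A_eq_closedBall, Metric.mem_closedBall] at h h'
    linarith [dist_triangle_right (D.Lam α d n w) w (D.z n)]
  · rw [D.Lam_of_notMem h, dist_self]
    linarith

theorem Lam_eq_self_of_dist_eq (h₀ : 0 < d) (hd : d < 1 / 2) {w : Torus}
    (h : dist w (D.z n) = d) : D.Lam α d n w = w := by
  have hd₁ : d < 1 := by linarith
  obtain ⟨t, s, ht, hs, rfl⟩ := (D.A_eq_closedBall d n).symm ▸ Metric.mem_closedBall.2 h.le
  rw [D.Lam_add hd ht hs]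
  rw [dist_self_add_left, Prod.norm_def, norm_coe_of_abs_le (by linarith),
    norm_coe_of_abs_le (by linarith)] at h
  rcases max_choice |t| |s| with e | e
  · rw [D.slide_eq_self_of_abs_fst h₀ hd₁ (e ▸ h) (abs_le.1 hs)]
  · rw [D.slide_eq_self_of_abs_snd h₀ hd₁ ht (e ▸ h)]

theorem continuousOn_Lam (h₀ : 0 < d) (hd : d < 1 / 2) :
    ContinuousOn (D.Lam α d n) (D.A d n) := by
  have coords : MapsTo (fun w : Torus => (rep (w.1 - (D.z n).1), rep (w.2 - (D.z n).2)))
      (D.A d n) (Icc (-d) d ×ˢ Icc (-d) d) := by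
    rintro _ ⟨t, s, ht, hs, rfl⟩
    simp only [Prod.fst_add, Prod.snd_add, add_sub_cancel_left]
    rw [rep_coe (ht.trans_lt hd), rep_coe (hs.trans_lt hd)]
    exact ⟨abs_le.1 ht, abs_le.1 hs⟩
  have slides := (D.continuousOn_slide (α := α) h₀ (by linarith)).comp (fun w hw => ?_) coords
  · refine ContinuousOn.congr (f := fun w : Torus => (w.1, (D.z n).2 +
      (D.slide α d (rep (w.1 - (D.z n).1)) (rep (w.2 - (D.z n).2)) : UnitAddCircle)))
      (continuousOn_fst.prodMk (continuousOn_const.add ?_)) fun w hw => if_pos hw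
    exact (AddCircle.continuous_mk' (1 : ℝ)).comp_continuousOn slides
  · rw [A_eq_closedBall, Metric.mem_closedBall, Prod.dist_eq, max_le_iff, dist_eq_norm,
      dist_eq_norm] at hw
    refine ContinuousAt.continuousWithinAt (ContinuousAt.prodMk ?_ ?_)
    · exact (continuousAt_rep (hw.1.trans_lt hd)).comp (f := fun w : Torus => w.1 - (D.z n).1)
        (by fun_prop)
    · exact (continuousAt_rep (hw.2.trans_lt hd)).comp (f := fun w : Torus => w.2 - (D.z n).2)
        (by fun_prop)

theorem continuous_Lam (h₀ : 0 < d) (hd : d < 1 / 2) (n : ℕ) : Continuous (D.Lam α d n) := by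
  have cover : D.A d n ∪ {w : Torus | d ≤ dist w (D.z n)} = univ := by
    rw [A_eq_closedBall]
    exact eq_univ_of_forall fun w => le_total (dist w (D.z n)) d
  rw [← continuousOn_univ, ← cover]
  refine (D.continuousOn_Lam h₀ hd).union_of_isClosed (continuousOn_id.congr fun w hw => ?_)
    (D.A_eq_closedBall d n ▸ Metric.isClosed_closedBall)
    (isClosed_le continuous_const (continuous_id.dist continuous_const))
  rcases (show d ≤ dist w (D.z n) from hw).eq_or_lt with h | h
  · exact D.Lam_eq_self_of_dist_eq h₀ hd h.symm
  · exact D.Lam_of_notMem (by rwa [A_eq_closedBall, Metric.mem_closedBall, not_le])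

theorem surjective_Lam (h₀ : 0 < d) (hd : d < 1 / 2) (n : ℕ) :
    Function.Surjective (D.Lam α d n) := by
  intro w
  by_cases h : w ∈ D.A d n
  · obtain ⟨t, s, ht, hs, rfl⟩ := h
    obtain ⟨r, hr, rfl⟩ := D.surjOn_slide (α := α) h₀ (by linarith) ht (abs_le.1 hs)
    exact ⟨_, D.Lam_add hd ht (abs_le.2 hr)⟩
  · exact ⟨w, D.Lam_of_notMem h⟩

theorem eq_or_eq_z_of_Lam_eq (h₀ : 0 < d) (hd : d < 1 / 2) {u v : Torus}
    (h : D.Lam α d n u = D.Lam α d n v) : u = v ∨ D.Lam α d n u = D.z n := by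
  by_cases hu : u ∈ D.A d n
  · have hv : v ∈ D.A d n := by
      rwa [← D.Lam_mem_iff h₀ hd, ← h, D.Lam_mem_iff h₀ hd]
    obtain ⟨t, s, ht, hs, rfl⟩ := hu
    obtain ⟨t', s', ht', hs', rfl⟩ := hv
    have hd₁ : d < 1 := by linarith
    have maps := D.mapsTo_slide (α := α) h₀ hd₁ ht
    rw [D.Lam_add hd ht hs] at h ⊢
    rw [D.Lam_add hd ht' hs', add_right_inj, Prod.mk.injEq] at h
    obtain rfl := eq_of_coe_eq (ht.trans_lt hd) (ht'.trans_lt hd) h.1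
    have heq := eq_of_coe_eq ((abs_le.2 (maps (abs_le.1 hs))).trans_lt hd)
      ((abs_le.2 (maps (abs_le.1 hs'))).trans_lt hd) h.2
    rcases D.eq_or_eq_zero_of_slide_eq h₀ hd₁ ht (abs_le.1 hs) (abs_le.1 hs') heq with
      rfl | ⟨rfl, hzero⟩
    · exact .inl rfl
    · right
      rw [hzero, AddCircle.coe_zero, Prod.mk_zero_zero, add_zero]
  · have hv : v ∉ D.A d n := by
      rwa [← D.Lam_mem_iff h₀ hd, ← h, D.Lam_mem_iff h₀ hd]
    rw [D.Lam_of_notMem hu, D.Lam_of_notMem hv] at h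
    exact .inl h

theorem dist_le_of_Lam_eq_z (h₀ : 0 < d) (hd : d < 1 / 2) {w : Torus}
    (h : D.Lam α d n w = D.z n) : dist w (D.z n) ≤ d / 2 := by
  have hw : w ∈ D.A d n := by
    rw [← D.Lam_mem_iff h₀ hd, h, A_eq_closedBall]
    exact Metric.mem_closedBall_self h₀.le
  obtain ⟨t, s, ht, hs, rfl⟩ := hw
  have hd₁ : d < 1 := by linarith
  have maps := D.mapsTo_slide (α := α) h₀ hd₁ ht (abs_le.1 hs)
  have hzero : |(0 : ℝ)| < 1 / 2 := by norm_num
  rw [D.Lam_add hd ht hs, add_eq_left, Prod.mk_eq_zero] at h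
  obtain rfl := eq_of_coe_eq (ht.trans_lt hd) hzero h.1
  have hs' := (D.slide_zero_eq_zero_iff h₀ hd₁ (abs_le.1 hs)).1
    (eq_of_coe_eq ((abs_le.2 maps).trans_lt hd) hzero h.2)
  rw [dist_self_add_left, Prod.norm_def, AddCircle.coe_zero, norm_zero]
  exact max_le (by linarith) ((norm_coe_le_abs s).trans hs')

theorem nontrivial_preimage_Lam (h₀ : 0 < d) (hd : d < 1 / 2) (n : ℕ) :
    (D.Lam α d n ⁻¹' {D.z n}).Nontrivial := by
  have hhalf : |d / 2| = d / 2 := abs_of_pos (by linarith)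
  have collapse {s : ℝ} (hs : |s| ≤ d / 2) :
      D.Lam α d n (D.z n + (((0 : ℝ) : UnitAddCircle), (s : UnitAddCircle))) = D.z n := by
    have hsd : |s| ≤ d := by linarith
    rw [D.Lam_add hd (abs_zero.trans_le h₀.le) hsd,
      (D.slide_zero_eq_zero_iff h₀ (by linarith) (abs_le.1 hsd)).2 hs, AddCircle.coe_zero,
      Prod.mk_zero_zero, add_zero]
  refine ⟨_, collapse (s := 0) (by rw [abs_zero]; linarith), _, collapse hhalf.le, fun h => ?_⟩
  rw [add_right_inj, Prod.mk.injEq] at h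
  have := eq_of_coe_eq (by norm_num) (by rw [hhalf]; linarith) h.2
  linarith

theorem Lam_comm {d' : ℝ} (h₀ : 0 < d) (hd : d < 1 / 2) (h₀' : 0 < d') (hd' : d' < 1 / 2)
    {m n : ℕ} (h : Disjoint (D.A d m) (D.A d' n)) :
    Function.Commute (D.Lam α d m) (D.Lam α d' n) := by
  intro w
  by_cases h₁ : w ∈ D.A d m
  · rw [D.Lam_of_notMem (disjoint_left.1 h h₁),
      D.Lam_of_notMem (disjoint_left.1 h (D.mapsTo_Lam h₀ hd h₁))]
  · rw [D.Lam_of_notMem h₁, D.Lam_of_notMem]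
    by_cases h₂ : w ∈ D.A d' n
    · exact disjoint_right.1 h (D.mapsTo_Lam h₀' hd' h₂)
    · rwa [D.Lam_of_notMem h₂]

end Square

section Orbit

theorem dense_range_zsmul_v : Dense (range fun k : ℤ => k • D.v) := by
  simpa only [zero_add] using D.minimal 0

theorem z_even (k : ℕ) : D.z (2 * k) = D.z₀ + k • D.v := by
  rw [z, if_pos (by omega), Nat.mul_div_cancel_left _ two_pos]

theorem z_odd (k : ℕ) : D.z (2 * k + 1) = D.z₀ - (k + 1) • D.v := by
  rw [z, if_neg (by omega), show (2 * k + 1) / 2 = k by omega]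

theorem range_z : range D.z = range fun k : ℤ => D.z₀ + k • D.v := by
  apply Subset.antisymm
  · rintro _ ⟨n, rfl⟩
    obtain ⟨k, rfl | rfl⟩ := Nat.even_or_odd' n
    · exact ⟨k, by simp only [z_even, natCast_zsmul]⟩
    · exact ⟨-(k + 1 : ℕ), by simp only [z_odd, neg_smul, natCast_zsmul, sub_eq_add_neg]⟩
  · rintro _ ⟨k | k, rfl⟩
    · exact ⟨2 * k, by simp only [z_even, Int.ofNat_eq_natCast, natCast_zsmul]⟩
    · exact ⟨2 * k + 1, by simp only [z_odd, negSucc_zsmul, sub_eq_add_neg]⟩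

theorem mem_X_iff {w : Torus} : w ∈ D.X ↔ ∀ k : ℤ, w.1 ≠ (D.z₀ + k • D.v).1 := by
  have h := forall_mem_range (f := D.z) (p := fun y => w.1 ≠ y.1)
  rw [range_z, forall_mem_range] at h
  exact h.symm

theorem mem_X_iff_of_fst_eq {u w : Torus} (h : u.1 = w.1) : u ∈ D.X ↔ w ∈ D.X := by
  simp only [X, mem_ofPred_eq, h]

theorem add_zsmul_mem_X {w : Torus} (hw : w ∈ D.X) (n : ℤ) : w + n • D.v ∈ D.X := by
  rw [mem_X_iff] at hw ⊢
  intro k hk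
  apply hw (k - n)
  rw [Prod.fst_add] at hk
  rw [eq_sub_of_add_eq hk, ← Prod.fst_sub, sub_smul, add_sub_assoc]

theorem mapsTo_T_X : MapsTo D.T D.X D.X := fun w hw => by
  simpa only [T, one_smul] using D.add_zsmul_mem_X hw 1

theorem mapsTo_Tinv_X : MapsTo D.Tinv D.X D.X := fun w hw => by
  simpa only [Tinv, neg_smul, one_smul, sub_eq_add_neg] using D.add_zsmul_mem_X hw (-1)

theorem continuous_T : Continuous D.T := continuous_id.add continuous_const

theorem continuous_Tinv : Continuous D.Tinv := continuous_id.sub continuous_const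

theorem dense_X : Dense D.X := by
  have : Nontrivial UnitAddCircle :=
    ⟨(0 : ℝ), (1 / 4 : ℝ), fun h => absurd
      (eq_of_coe_eq (by norm_num) (by norm_num [abs_of_pos]) h) (by norm_num)⟩
  have columns : D.X = ⋂ n, {w : Torus | w.1 ≠ (D.z n).1} := by
    ext w
    simp only [X, mem_ofPred_eq, mem_iInter]
  rw [columns]
  exact dense_iInter_of_isOpen_nat (fun n => isOpen_ne_fun continuous_fst continuous_const)
    fun n => (dense_compl_singleton (D.z n).1).preimage isOpenMap_fst

end Orbit

section Composition

variable {D} {α : ℕ → unitInterval} {δ : ℕ → ℝ}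

theorem PhiAlong_succ (e : ℕ → ℕ) (n : ℕ) : D.PhiAlong α δ e (n + 1) =
    D.Lam α (δ (e (n + 1))) (e (n + 1)) ∘ D.PhiAlong α δ e n := rfl

theorem PhiN_succ (n : ℕ) : D.PhiN α δ (n + 1) =
    D.Lam α (δ (n + 1)) (n + 1) ∘ D.PhiN α δ n := rfl

theorem PhiAlong_fst (e : ℕ → ℕ) (n : ℕ) (w : Torus) : (D.PhiAlong α δ e n w).1 = w.1 := by
  induction n with
  | zero => exact D.Lam_fst _ _
  | succ n ih => rw [PhiAlong_succ, Function.comp_apply, Lam_fst, ih]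

theorem PhiN_fst (n : ℕ) (w : Torus) : (D.PhiN α δ n w).1 = w.1 := PhiAlong_fst id n w

namespace Admissible

variable (hA : D.Admissible α δ)
include hA

theorem lt_half (n : ℕ) : δ n < 1 / 2 := by
  by_contra! h
  have hmem : D.z (n + 1) ∈ D.A (δ (n + 1)) (n + 1) := by
    rw [A_eq_closedBall]
    exact Metric.mem_closedBall_self (hA.pos _).le
  refine disjoint_right.1 (hA.disjoint n (n + 1) n.lt_succ_self (by omega)) hmem ?_
  have norm_le (x : UnitAddCircle) : ‖x‖ ≤ 1 / 2 := by
    simpa using AddCircle.norm_le_half_period 1 one_ne_zero (x := x)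
  rw [A_eq_closedBall, Metric.mem_closedBall, Prod.dist_eq, dist_eq_norm, dist_eq_norm]
  exact max_le ((norm_le _).trans h) ((norm_le _).trans h)

theorem z_fst_ne {m n : ℕ} (h : m ≠ n) : (D.z m).1 ≠ (D.z n).1 := by
  wlog hmn : m < n generalizing m n
  · exact (this h.symm (by omega)).symm
  intro e
  have := hA.lt_dist m n hmn
  rw [e, dist_self, zero_div] at this
  exact lt_asymm this (hA.pos n)

theorem continuous_PhiAlong (e : ℕ → ℕ) (n : ℕ) : Continuous (D.PhiAlong α δ e n) := by
  induction n with
  | zero => exact D.continuous_Lam (hA.pos _) (hA.lt_half _) _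
  | succ n ih => exact (D.continuous_Lam (hA.pos _) (hA.lt_half _) _).comp ih

theorem surjective_PhiAlong (e : ℕ → ℕ) (n : ℕ) : Function.Surjective (D.PhiAlong α δ e n) := by
  induction n with
  | zero => exact D.surjective_Lam (hA.pos _) (hA.lt_half _) _
  | succ n ih => exact (D.surjective_Lam (hA.pos _) (hA.lt_half _) _).comp ih

theorem eq_or_fst_eq_of_PhiN_eq {n : ℕ} {u v : Torus} (h : D.PhiN α δ n u = D.PhiN α δ n v) :
    u = v ∨ ∃ m ≤ n, u.1 = (D.z m).1 := by
  induction n with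
  | zero =>
    refine (D.eq_or_eq_z_of_Lam_eq (hA.pos _) (hA.lt_half _) h).imp_right fun e => ⟨0, le_rfl, ?_⟩
    exact (D.Lam_fst _ _).symm.trans (congrArg Prod.fst e)
  | succ n ih =>
    rcases D.eq_or_eq_z_of_Lam_eq (hA.pos _) (hA.lt_half _) h with e | e
    · exact (ih e).imp_right fun ⟨m, hm, e'⟩ => ⟨m, by omega, e'⟩
    · exact .inr ⟨n + 1, le_rfl, (PhiN_fst (n + 1) u).symm.trans (congrArg Prod.fst e)⟩

theorem dist_PhiN_succ_le (n : ℕ) (w : Torus) :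
    dist (D.PhiN α δ n w) (D.PhiN α δ (n + 1) w) ≤ 2 / 2 / 2 ^ n := by
  rw [dist_comm]
  calc dist (D.PhiN α δ (n + 1) w) (D.PhiN α δ n w)
      ≤ 2 * δ (n + 1) := D.dist_Lam_le (hA.pos _) (hA.lt_half _) (n + 1) _
    _ ≤ 2 * (1 / 2 ^ (n + 1)) := by gcongr; exact (hA.lt_pow (n + 1)).le
    _ = 2 / 2 / 2 ^ n := by rw [pow_succ]; field_simp

theorem tendsto_PhiN (w : Torus) :
    Tendsto (fun n => D.PhiN α δ n w) atTop (𝓝 (D.Phi α δ w)) :=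
  (cauchySeq_of_le_geometric_two fun n => hA.dist_PhiN_succ_le n w).tendsto_limUnder

theorem tendstoUniformly_PhiN : TendstoUniformly (D.PhiN α δ) (D.Phi α δ) atTop := by
  rw [Metric.tendstoUniformly_iff]
  intro ε hε
  have geometric : Tendsto (fun n : ℕ => (2 : ℝ) / 2 ^ n) atTop (𝓝 0) :=
    tendsto_const_nhds.div_atTop (tendsto_pow_atTop_atTop_of_one_lt one_lt_two)
  filter_upwards [geometric.eventually (gt_mem_nhds hε)] with n hn w
  rw [dist_comm]
  exact (dist_le_of_le_geometric_two_of_tendsto (fun n => hA.dist_PhiN_succ_le n w)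
    (hA.tendsto_PhiN w) n).trans_lt hn

theorem continuous_Phi : Continuous (D.Phi α δ) :=
  hA.tendstoUniformly_PhiN.continuous (Frequently.of_forall (hA.continuous_PhiAlong id))

theorem Phi_fst (w : Torus) : (D.Phi α δ w).1 = w.1 :=
  tendsto_nhds_unique (hA.tendsto_PhiN w).fst_nhds (by simp only [PhiN_fst, tendsto_const_nhds])

theorem Phi_mem_X_iff {w : Torus} : D.Phi α δ w ∈ D.X ↔ w ∈ D.X :=
  D.mem_X_iff_of_fst_eq (hA.Phi_fst w)

theorem surjective_Phi : Function.Surjective (D.Phi α δ) := by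
  rw [← range_eq_univ, eq_univ_iff_forall]
  intro y
  rw [← (isCompact_range hA.continuous_Phi).isClosed.closure_eq, Metric.mem_closure_iff]
  intro ε hε
  obtain ⟨n, hn⟩ := (Metric.tendstoUniformly_iff.1 hA.tendstoUniformly_PhiN ε hε).exists
  obtain ⟨w, rfl⟩ := hA.surjective_PhiAlong id n y
  exact ⟨_, mem_range_self w, by rw [dist_comm]; exact hn w⟩

theorem Phi_eq_PhiN {n : ℕ} {u : Torus} (hu : u.1 = (D.z n).1) :
    D.Phi α δ u = D.PhiN α δ n u := by
  refine tendsto_nhds_unique (hA.tendsto_PhiN u) (tendsto_atTop_of_eventually_const (i₀ := n) ?_)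
  intro m hm
  induction m, hm using Nat.le_induction with
  | base => rfl
  | succ m hm ih =>
    rw [PhiN_succ, Function.comp_apply, ih]
    refine D.Lam_of_notMem fun h => ?_
    exact disjoint_right.1 (hA.column n (m + 1) (by omega)) h ((PhiN_fst n u).trans hu)

theorem exists_mul_tdist_PhiN_le : ∃ l > 0, ∀ (n : ℕ) (u v : Torus), 1 ≤ n →
    1 / (n : ℝ) ≤ tdist u v →
    l * tdist (D.PhiN α δ n u) (D.PhiN α δ n v) ≤ tdist (D.Phi α δ u) (D.Phi α δ v) := by
  obtain ⟨a, -, ⟨l, hl, hlim⟩, hexp⟩ := hA.expand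
  have factor (r : ℕ) : 1 / (a r : ℝ) ≤ 1 := by
    rw [one_div]
    exact Nat.cast_inv_le_one (a r)
  have le_prod := le_prod_Ioc_of_tendsto (fun r => sub_nonneg.2 (factor r))
    (fun r => sub_le_self 1 (by positivity)) hlim
  refine ⟨l, hl, fun n u v hn huv => ge_of_tendsto
    (tendsto_tdist (hA.tendsto_PhiN u) (hA.tendsto_PhiN v)) ?_⟩
  filter_upwards [eventually_gt_atTop n] with m hm
  exact (mul_le_mul_of_nonneg_right (le_prod n m) (Real.sqrt_nonneg _)).trans
    (hexp n hn u v huv m hm)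

theorem eq_of_Phi_eq {u v : Torus} (hu : u ∈ D.X) (h : D.Phi α δ u = D.Phi α δ v) : u = v := by
  by_contra hne
  obtain ⟨l, hl, hle⟩ := hA.exists_mul_tdist_PhiN_le
  obtain ⟨n, hn⟩ := exists_nat_one_div_lt ((dist_pos.2 hne).trans_le (dist_le_tdist u v))
  have hpos : 0 < tdist (D.PhiN α δ (n + 1) u) (D.PhiN α δ (n + 1) v) := by
    refine (dist_pos.2 fun e => ?_).trans_le (dist_le_tdist _ _)
    obtain ⟨m, -, hm⟩ := (hA.eq_or_fst_eq_of_PhiN_eq e).resolve_left hne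
    exact hu m hm
  have hPhi := hle (n + 1) u v (by omega) (by exact_mod_cast hn.le)
  rw [h, tdist_of_fst_eq rfl, dist_self] at hPhi
  exact (mul_pos hl hpos).not_ge hPhi

theorem bijOn_Phi_X : BijOn (D.Phi α δ) D.X D.X := by
  refine ⟨fun w => hA.Phi_mem_X_iff.2, fun u hu v _ => hA.eq_of_Phi_eq hu, fun y hy => ?_⟩
  obtain ⟨w, rfl⟩ := hA.surjective_Phi y
  exact ⟨w, hA.Phi_mem_X_iff.1 hy, rfl⟩

theorem eq_or_Phi_eq_z {u v : Torus} (h : D.Phi α δ u = D.Phi α δ v) :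
    u = v ∨ ∃ n, D.Phi α δ u = D.z n := by
  by_cases hu : u ∈ D.X
  · exact .inl (hA.eq_of_Phi_eq hu h)
  simp only [X, mem_ofPred_eq, not_forall, not_not] at hu
  obtain ⟨n, hn⟩ := hu
  have hv : v.1 = (D.z n).1 := by rw [← hA.Phi_fst v, ← h, hA.Phi_fst u, hn]
  rw [hA.Phi_eq_PhiN hn, hA.Phi_eq_PhiN hv] at h
  rw [hA.Phi_eq_PhiN hn]
  rcases n with _ | n
  · exact (D.eq_or_eq_z_of_Lam_eq (hA.pos _) (hA.lt_half _) h).imp_right fun e => ⟨0, e⟩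
  rcases D.eq_or_eq_z_of_Lam_eq (hA.pos _) (hA.lt_half _) h with e | e
  · refine .inl ((hA.eq_or_fst_eq_of_PhiN_eq e).resolve_right ?_)
    rintro ⟨m, hm, hum⟩
    exact hA.z_fst_ne (by omega : m ≠ n + 1) (hum.symm.trans hn)
  · exact .inr ⟨n + 1, e⟩

theorem diam_preimage_Phi_le (n : ℕ) :
    Metric.diam (D.Phi α δ ⁻¹' {D.z (n + 1)}) ≤ 1 / ((n : ℝ) + 1) := by
  have column {w : Torus} (hw : D.Phi α δ w = D.z (n + 1)) : w.1 = (D.z (n + 1)).1 := by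
    rw [← hA.Phi_fst w, hw]
  have near {w : Torus} (hw : D.Phi α δ w = D.z (n + 1)) :
      dist (D.PhiN α δ n w).2 (D.z (n + 1)).2 ≤ δ (n + 1) / 2 := by
    refine (le_max_right _ _).trans (D.dist_le_of_Lam_eq_z (α := α) (hA.pos _) (hA.lt_half _) ?_)
    exact (hA.Phi_eq_PhiN (column hw)).symm.trans hw
  refine Metric.diam_le_of_forall_dist_le (by positivity) fun u hu v hv => ?_
  refine (dist_le_tdist u v).trans (hA.fibre n u v (column hu) (column hv) ?_).le
  rw [tdist_of_fst_eq (by rw [PhiN_fst, PhiN_fst, column hu, column hv])]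
  linarith [near hu, near hv, dist_triangle_right (D.PhiN α δ n u).2 (D.PhiN α δ n v).2
    (D.z (n + 1)).2]

theorem nontrivial_preimage_Phi : (D.Phi α δ ⁻¹' {D.z₀}).Nontrivial := by
  have hz : D.z 0 = D.z₀ := by simpa using D.z_even 0
  rw [← hz]
  refine (D.nontrivial_preimage_Lam (α := α) (hA.pos 0) (hA.lt_half 0) 0).mono fun w hw => ?_
  have hw' : D.Lam α (δ 0) 0 w = D.z 0 := hw
  exact (hA.Phi_eq_PhiN (n := 0) (by rw [← hw', Lam_fst])).trans hw'

theorem orbitBlowup : OrbitBlowup D.v D.z₀ (D.Phi α δ) where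
  continuous := hA.continuous_Phi
  eq_or_mem_orbit u v h := (hA.eq_or_Phi_eq_z h).imp_right fun ⟨n, hn⟩ => by
    obtain ⟨k, hk⟩ := D.range_z ▸ mem_range_self n
    exact ⟨k, hn.trans hk.symm⟩
  dense_compl_orbit := D.dense_X.mono fun w hw k hk =>
    D.mem_X_iff.1 hw k (by rw [← hk, hA.Phi_fst])
  tendsto_diam := by
    rw [← tendsto_add_atTop_iff_nat 1]
    refine squeeze_zero (fun _ => Metric.diam_nonneg) (fun n => ?_)
      (tendsto_one_div_add_atTop_nhds_zero_nat.comp (tendsto_two_mul_add_atTop 1))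
    rw [← z_even]
    exact hA.diam_preimage_Phi_le (2 * n + 1)
  nontrivial := hA.nontrivial_preimage_Phi

theorem Lam_comm {m n : ℕ} (hne : m ≠ n) (hm : m ≤ n + 5) (hn : n ≤ m + 5) :
    D.Lam α (δ m) m ∘ D.Lam α (δ n) n = D.Lam α (δ n) n ∘ D.Lam α (δ m) m := by
  refine (D.Lam_comm (hA.pos _) (hA.lt_half _) (hA.pos _) (hA.lt_half _) ?_).comp_eq
  rcases lt_or_gt_of_ne hne with h | h
  · exact hA.disjoint m n h hn
  · exact (hA.disjoint n m h hm).symm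

theorem PhiAlong_sigma (k : ℕ) : D.PhiAlong α δ sigma (2 * k + 1) =
    D.Lam α (δ (2 * k + 2)) (2 * k + 2) ∘ D.PhiN α δ (2 * k) := by
  induction k with
  | zero => exact hA.Lam_comm (m := 0) (n := 2) (by omega) (by omega) (by omega)
  | succ k ih =>
    have swap₁ := hA.Lam_comm (m := 2 * k + 1) (n := 2 * k + 4) (by omega) (by omega) (by omega)
    have swap₂ := hA.Lam_comm (m := 2 * k + 1) (n := 2 * k + 2) (by omega) (by omega) (by omega)
    have h₁ := sigma_two_mul (k + 1)
    have h₂ := sigma_two_mul_add_three k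
    simp only [mul_add, mul_one] at h₁ ⊢
    rw [PhiAlong_succ, PhiAlong_succ, ih, h₁, h₂, PhiN_succ, PhiN_succ, ← Function.comp_assoc,
      swap₁, Function.comp_assoc, ← Function.comp_assoc _ _ (D.PhiN α δ (2 * k)), swap₂]
    rfl

theorem PhiAlong_tau (k : ℕ) : D.PhiAlong α δ tau (2 * k + 2) =
    D.Lam α (δ (2 * k + 3)) (2 * k + 3) ∘ D.PhiN α δ (2 * k + 1) := by
  induction k with
  | zero =>
    have swap₁ := hA.Lam_comm (m := 0) (n := 3) (by omega) (by omega) (by omega)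
    have swap₂ := hA.Lam_comm (m := 0) (n := 1) (by omega) (by omega) (by omega)
    calc D.PhiAlong α δ tau 2 = (D.Lam α (δ 0) 0 ∘ D.Lam α (δ 3) 3) ∘ D.Lam α (δ 1) 1 := rfl
      _ = D.Lam α (δ 3) 3 ∘ D.PhiN α δ 1 := by rw [swap₁, Function.comp_assoc, swap₂]; rfl
  | succ k ih =>
    have swap₁ := hA.Lam_comm (m := 2 * k + 2) (n := 2 * k + 5) (by omega) (by omega) (by omega)
    have swap₂ := hA.Lam_comm (m := 2 * k + 2) (n := 2 * k + 3) (by omega) (by omega) (by omega)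
    have h₁ := tau_two_mul_add_one (k + 1)
    have h₂ := tau_two_mul_add_two (k + 1)
    simp only [mul_add, mul_one] at h₁ h₂ ⊢
    rw [PhiAlong_succ, PhiAlong_succ, ih, h₁, h₂, PhiN_succ (2 * k + 2), PhiN_succ (2 * k + 1),
      ← Function.comp_assoc, swap₁, Function.comp_assoc,
      ← Function.comp_assoc _ _ (D.PhiN α δ (2 * k + 1)), swap₂]
    rfl

theorem tendstoUniformly_Lam : TendstoUniformly (fun n => D.Lam α (δ n) n) id atTop := by
  rw [Metric.tendstoUniformly_iff]
  intro ε hε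
  have geometric : Tendsto (fun n : ℕ => 2 * (1 / 2 : ℝ) ^ n) atTop (𝓝 0) := by
    simpa using (tendsto_pow_atTop_nhds_zero_of_lt_one one_half_pos.le
      one_half_lt_one).const_mul (2 : ℝ)
  filter_upwards [geometric.eventually (gt_mem_nhds hε)] with n hn w
  rw [dist_comm]
  have hδ := hA.lt_pow n
  rw [← one_div_pow] at hδ
  exact (D.dist_Lam_le (hA.pos n) (hA.lt_half n) n w).trans_lt (by linarith)

theorem tendstoUniformly_Lam_comp_PhiN {i j : ℕ → ℕ} (hi : Tendsto i atTop atTop)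
    (hj : Tendsto j atTop atTop) :
    TendstoUniformly (fun k => D.Lam α (δ (i k)) (i k) ∘ D.PhiN α δ (j k)) (D.Phi α δ) atTop :=
  tendstoUniformly_comp_of_tendsto_id (fun U hU => hi.eventually (hA.tendstoUniformly_Lam U hU))
    fun U hU => hj.eventually (hA.tendstoUniformly_PhiN U hU)

theorem PhiAlong_invFunOn (e : ℕ → ℕ) (n : ℕ) {y : Torus} (hy : y ∈ D.X) :
    D.PhiAlong α δ e n (Function.invFunOn (D.PhiAlong α δ e n) D.X y) = y := by
  obtain ⟨u, rfl⟩ := hA.surjective_PhiAlong e n y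
  exact Function.invFunOn_eq ⟨u, (D.mem_X_iff_of_fst_eq (PhiAlong_fst e n u)).1 hy, rfl⟩

theorem semiconj_of_tendsto {R F : Torus → Torus} (hR : Continuous R) (hRX : MapsTo R D.X D.X)
    {e i : ℕ → ℕ} (hi : Tendsto i atTop atTop)
    (he : TendstoUniformly (fun k => D.PhiAlong α δ e (i k)) (D.Phi α δ) atTop)
    (hF : Continuous F) (hlim : ∀ u ∈ D.X, Tendsto (fun n =>
      Function.invFunOn (D.PhiAlong α δ e n) D.X (R (D.PhiN α δ n u))) atTop (𝓝 (F u))) :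
    Function.Semiconj (D.Phi α δ) F R := by
  refine congrFun (Continuous.ext_on D.dense_X (hA.continuous_Phi.comp hF)
    (hR.comp hA.continuous_Phi) fun u hu => ?_)
  have lhs := he.tendsto_comp hA.continuous_Phi.continuousAt ((hlim u hu).comp hi)
  have rhs := (hR.tendsto _).comp ((hA.tendsto_PhiN u).comp hi)
  refine tendsto_nhds_unique lhs (rhs.congr fun k => ?_)
  exact (hA.PhiAlong_invFunOn e (i k)
    (hRX ((D.mem_X_iff_of_fst_eq (PhiN_fst _ u)).2 hu))).symm

theorem exists_continuous_semiconj_T :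
    ∃ F, Continuous F ∧ Function.Semiconj (D.Phi α δ) F D.T := by
  obtain ⟨F, hF, hlim⟩ :=
    exists_continuous_of_uniformCauchySeqOn D.dense_X hA.fwd_unif hA.fwd_cauchy
  refine ⟨F, hF, hA.semiconj_of_tendsto D.continuous_T D.mapsTo_T_X
    (tendsto_two_mul_add_atTop 1) ?_ hF hlim⟩
  simp only [hA.PhiAlong_sigma]
  exact hA.tendstoUniformly_Lam_comp_PhiN (tendsto_two_mul_add_atTop 2)
    (tendsto_two_mul_add_atTop 0)

theorem exists_continuous_semiconj_Tinv :
    ∃ F, Continuous F ∧ Function.Semiconj (D.Phi α δ) F D.Tinv := by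
  obtain ⟨F, hF, hlim⟩ :=
    exists_continuous_of_uniformCauchySeqOn D.dense_X hA.bwd_unif hA.bwd_cauchy
  refine ⟨F, hF, hA.semiconj_of_tendsto D.continuous_Tinv D.mapsTo_Tinv_X
    (tendsto_two_mul_add_atTop 2) ?_ hF hlim⟩
  simp only [hA.PhiAlong_tau]
  exact hA.tendstoUniformly_Lam_comp_PhiN (tendsto_two_mul_add_atTop 3)
    (tendsto_two_mul_add_atTop 1)

theorem isExtension_iff_semiconj {S : Torus ≃ₜ Torus} :
    D.IsExtension α δ S ↔ Function.Semiconj (D.Phi α δ) S D.T := by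
  have inv := hA.bijOn_Phi_X.invOn_invFunOn
  have maps {u : Torus} (hu : u ∈ D.X) : D.T (D.Phi α δ u) ∈ D.X :=
    D.mapsTo_T_X (hA.Phi_mem_X_iff.2 hu)
  constructor
  · intro h
    refine congrFun (Continuous.ext_on D.dense_X (hA.continuous_Phi.comp S.continuous)
      (D.continuous_T.comp hA.continuous_Phi) fun u hu => ?_)
    exact (congrArg _ (h hu)).trans (inv.2 (maps hu))
  · intro h u hu
    have hSu : S u ∈ D.X := hA.Phi_mem_X_iff.1 (h.eq u ▸ maps hu)
    exact (inv.1 hSu).symm.trans (congrArg _ (h.eq u))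

theorem existsUnique_extension : ∃! S : Torus ≃ₜ Torus, D.IsExtension α δ S := by
  obtain ⟨F, hF, hFT⟩ := hA.exists_continuous_semiconj_T
  obtain ⟨F', hF', hFT'⟩ := hA.exists_continuous_semiconj_Tinv
  obtain ⟨S, rfl⟩ := exists_homeomorph_of_semiconj D.dense_X
    (fun u hu x h => (hA.eq_of_Phi_eq hu h.symm).symm) (fun w => sub_add_cancel w D.v)
    (fun w => add_sub_cancel_right w D.v) hF hF' hFT hFT'
  have hS := hA.isExtension_iff_semiconj.2 hFT
  refine ⟨S, hS, fun S' hS' => Homeomorph.ext fun u => ?_⟩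
  exact congrFun (Continuous.ext_on D.dense_X S'.continuous S.continuous
    (hS'.trans hS.symm)) u

end Admissible

end Composition

end Setup

end DenjoyRees

theorem mainTheorem5 (D : DenjoyRees.Setup) (α β : ℕ → unitInterval) (δα δβ : ℕ → ℝ)
    (hα : D.Admissible α δα) (hβ : D.Admissible β δβ) :
    (∃! Sα : DenjoyRees.Torus ≃ₜ DenjoyRees.Torus, D.IsExtension α δα Sα) ∧
    (∃! Sβ : DenjoyRees.Torus ≃ₜ DenjoyRees.Torus, D.IsExtension β δβ Sβ) ∧
    ∀ Sα Sβ : DenjoyRees.Torus ≃ₜ DenjoyRees.Torus,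
      D.IsExtension α δα Sα → D.IsExtension β δβ Sβ →
      ∀ w w' : ℕ → DenjoyRees.Torus,
        (∀ n, D.Phi α δα (w n) = D.z (2 * n)) →
        (∀ n, D.Phi β δβ (w' n) = D.z (2 * n)) →
        (TopConjugate Sα Sβ ↔ Ett w w') := by
  refine ⟨hα.existsUnique_extension, hβ.existsUnique_extension,
    fun Sα Sβ hSα hSβ w w' hw hw' => ?_⟩
  simp only [D.z_even] at hw hw'
  exact hα.orbitBlowup.topConjugate_iff_ett hβ.orbitBlowup D.dense_range_zsmul_v
    (hα.isExtension_iff_semiconj.1 hSα) (hβ.isExtension_iff_semiconj.1 hSβ) hw hw'
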